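/- Let $\lambda,\delta,b>0$, $r\in(0,1]$ and $c_2<c_1$. Let $X_1,X_2,\dots$ be i.i.d. non-negative claim sizes with density $f$, distribution function $F$ and tail $\bar F=1-F$, and let $N$ be an independent Poisson process with intensity $\lambda$; put $S(t)=\sum_{i=1}^{N_t}X_i$ and assume $EX_1<\infty$ and $c_2>\lambda EX_1$. Let $U_b$ be the refracted risk process with $U_b(0)=u$ and $$dU_b(t)=\begin{cases}c_1\,dt-dS(t),&U_b(t)\le b,\\ c_2\,dt-dS(t),&U_b(t)>b,\end{cases}$$ let $\tau=\inf\{t>0:U_b(t)<0\}$ be its ruin time, and let $$\phi(u)=E\big[r^{N_\tau}e^{-\delta\tau}\mathbf 1_{\{\tau<\infty\}}\,\big|\,U_b(0)=u\big].$$ Write $\phi_1(u)=\phi(u)$ for $0\le u\le b$ and $\phi_2(u)=\phi(u)$ for $u>b$. For $s>0$ and $x\ge0$ let $T_sg(x)=\int_x^\infty e^{-s(y-x)}g(y)\,dy$, let $(g*k)(t)=\int_0^t g(x)k(t-x)\,dx$, and let $g^{n*}$ be the $n$-fold convolution of $g$ with itself ($g^{0*}$ is the unit mass at $0$, so $g^{0*}*k=k$).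 Then the Lundberg equation $c_2s-(\lambda+\delta)+\lambda r\int_0^\infty e^{-sx}f(x)\,dx=0$ has exactly one positive root $\rho_2$, and for every $u>b$ $$\phi_2(u)=\sum_{n=0}^\infty\Big(\frac{\lambda r}{c_2}\Big)^{n+1}\big((T_{\rho_2}f)^{n*}*h\big)(u-b),$$ where the series converges and $$h(y)=\int_y^{y+b}\phi_1(y+b-x)\,T_{\rho_2}f(x)\,dx+T_{\rho_2}\bar F(y+b),\qquad y\ge0.$$ Moreover, for every $u>b$, $\phi_2$ satisfies the renewal equation $$\phi_2(u)=\frac{\lambda r}{c_2}\Big[\int_0^{u-b}\phi_2(u-x)\,T_{\rho_2}f(x)\,dx+\int_{u-b}^u\phi_1(u-x)\,T_{\rho_2}f(x)\,dx+T_{\rho_2}\bar F(u)\Big],$$ which is defective: $T_{\rho_2}f$ is integrable on $(0,\infty)$ and $\frac{\lambda r}{c_2}\int_0^\infty T_{\rho_2}f(x)\,dx<1$. -/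

import Mathlib

open MeasureTheory ProbabilityTheory Set
open scoped ENNReal

noncomputable section

/-! ### The refracted risk process, path by path

`w i` is the waiting time between the `i`-th and the `(i+1)`-st claim and `x i` is the size of the
`(i+1)`-st claim. -/

/-- The time `T_n = w_0 + ... + w_{n-1}` of the `n`-th claim (`T_0 = 0`). -/
def claimTime (w : ℕ → ℝ) (n : ℕ) : ℝ := ∑ i ∈ Finset.range n, w i

/-- The number `N_t` of claims in `[0, t]`. If the `w i` are independent and exponentially
distributed with parameter `lam`, this is the Poisson process with intensity `lam`. -/
def claimCount (w : ℕ → ℝ) (t : ℝ) : ℕ := {n : ℕ | claimTime w (n + 1) ≤ t}.ncard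

/-- The surplus at time `t` when there are no claims in `[0, t]` and the surplus at time `0` is
`v`: it grows at rate `c₁` up to the level `b` and at rate `c₂` above `b`. -/
def refractedFlow (c₁ c₂ b v t : ℝ) : ℝ :=
  if b < v then v + c₂ * t
  else if v + c₁ * t ≤ b then v + c₁ * t
  else b + c₂ * (t - (b - v) / c₁)

/-- The surplus immediately after the `n`-th claim, with initial capital `u`. -/
def surplusAfterClaim (c₁ c₂ b u : ℝ) (w x : ℕ → ℝ) : ℕ → ℝ
  | 0 => u
  | n + 1 => refractedFlow c₁ c₂ b (surplusAfterClaim c₁ c₂ b u w x n) (w n) - x n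

/-- The refracted risk process `U_b(t)` with `U_b(0) = u`: premium rate `c₁` while it is at most
`b`, premium rate `c₂` while it is above `b`, and a downward jump by `x i` at the time of the
`(i+1)`-st claim. -/
def refractedSurplus (c₁ c₂ b u : ℝ) (w x : ℕ → ℝ) (t : ℝ) : ℝ :=
  refractedFlow c₁ c₂ b (surplusAfterClaim c₁ c₂ b u w x (claimCount w t))
    (t - claimTime w (claimCount w t))

/-- The ruin time `τ = inf {t > 0 : U_b(t) < 0}`, equal to `∞` if there is no ruin. -/
def ruinTime (c₁ c₂ b u : ℝ) (w x : ℕ → ℝ) : ℝ≥0∞ :=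
  sInf {s : ℝ≥0∞ | ∃ t : ℝ, 0 < t ∧ refractedSurplus c₁ c₂ b u w x t < 0 ∧ s = ENNReal.ofReal t}

/-- The refracted flow solves `dV = (c₁ 1_{V ≤ b} + c₂ 1_{V > b}) dt`, `V(0) = v`. -/
theorem refractedFlow_eq_integral {c₁ c₂ : ℝ} (hc₁ : 0 < c₁) (hc₂ : 0 < c₂) (b v : ℝ) {t : ℝ}
    (ht : 0 ≤ t) :
    IntervalIntegrable (fun s => if refractedFlow c₁ c₂ b v s ≤ b then c₁ else c₂) volume 0 t ∧
    refractedFlow c₁ c₂ b v t =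
      v + ∫ s in (0 : ℝ)..t, if refractedFlow c₁ c₂ b v s ≤ b then c₁ else c₂ := by
  have hmeas : Measurable (fun s => refractedFlow c₁ c₂ b v s) := by
    unfold refractedFlow
    split_ifs
    · fun_prop
    · exact Measurable.ite (measurableSet_le (by fun_prop) (by fun_prop)) (by fun_prop)
        (by fun_prop)
  have hint : ∀ x y : ℝ, IntervalIntegrable
      (fun s => if refractedFlow c₁ c₂ b v s ≤ b then c₁ else c₂) volume x y := by
    intro x y
    refine (intervalIntegrable_const (c := max c₁ c₂)).mono_fun ?_ ?_
    · exact (Measurable.ite (measurableSet_le hmeas measurable_const) measurable_const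
        measurable_const).aestronglyMeasurable
    · filter_upwards with s
      have h : 0 < max c₁ c₂ := lt_max_of_lt_left hc₁
      rw [Real.norm_of_nonneg h.le]
      split_ifs
      · rw [Real.norm_of_nonneg hc₁.le]; exact le_max_left _ _
      · rw [Real.norm_of_nonneg hc₂.le]; exact le_max_right _ _
  refine ⟨hint 0 t, ?_⟩
  by_cases hv : b < v
  · have h : ∀ s ∈ uIcc 0 t, (if refractedFlow c₁ c₂ b v s ≤ b then c₁ else c₂) = c₂ := by
      intro s hs
      rw [uIcc_of_le ht] at hs
      have := mul_nonneg hc₂.le hs.1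
      rw [if_neg]
      simp only [refractedFlow, if_pos hv, not_le]
      linarith
    rw [intervalIntegral.integral_congr h]
    simp [refractedFlow, hv, mul_comm]
  · have hlow : ∀ s, v + c₁ * s ≤ b → refractedFlow c₁ c₂ b v s = v + c₁ * s := by
      intro s hs
      simp [refractedFlow, hv, hs]
    have hhigh : ∀ s, b < v + c₁ * s →
        refractedFlow c₁ c₂ b v s = b + c₂ * (s - (b - v) / c₁) := by
      intro s hs
      simp [refractedFlow, hv, not_le.2 hs]
    have hconst : ∀ y, 0 ≤ y → v + c₁ * y ≤ b →
        ∫ s in (0 : ℝ)..y, (if refractedFlow c₁ c₂ b v s ≤ b then c₁ else c₂) = c₁ * y := by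
      intro y hy hyb
      have h : ∀ s ∈ uIcc 0 y, (if refractedFlow c₁ c₂ b v s ≤ b then c₁ else c₂) = c₁ := by
        intro s hs
        rw [uIcc_of_le hy] at hs
        have h2 : v + c₁ * s ≤ b := by nlinarith [hs.2]
        rw [hlow s h2, if_pos h2]
      rw [intervalIntegral.integral_congr h]
      simp [mul_comm]
    by_cases htb : v + c₁ * t ≤ b
    · rw [hconst t ht htb, hlow t htb]
    · push Not at htb
      have ha : 0 ≤ (b - v) / c₁ := div_nonneg (by linarith) hc₁.le
      have hca : c₁ * ((b - v) / c₁) = b - v := by field_simp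
      have hat : (b - v) / c₁ ≤ t := by
        rw [div_le_iff₀ hc₁]; linarith
      rw [← intervalIntegral.integral_add_adjacent_intervals (hint 0 ((b - v) / c₁))
        (hint ((b - v) / c₁) t), hconst _ ha (by linarith), hhigh t htb]
      have h : ∫ s in ((b - v) / c₁)..t, (if refractedFlow c₁ c₂ b v s ≤ b then c₁ else c₂)
          = ∫ s in ((b - v) / c₁)..t, c₂ := by
        refine intervalIntegral.integral_congr_ae ?_
        filter_upwards with s hs
        rw [uIoc_of_le hat] at hs
        have h2 : b < v + c₁ * s := by nlinarith [hs.1, mul_lt_mul_of_pos_left hs.1 hc₁]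
        rw [hhigh s h2, if_neg]
        have := mul_pos hc₂ (sub_pos.2 hs.1)
        linarith
      rw [h, intervalIntegral.integral_const, hca, smul_eq_mul]
      ring

theorem claimCount_eq {w : ℕ → ℝ} (hw : ∀ i, 0 < w i) {n : ℕ} {t : ℝ}
    (h₁ : claimTime w n ≤ t) (h₂ : t < claimTime w (n + 1)) : claimCount w t = n := by
  have hmono : StrictMono (claimTime w) := by
    refine strictMono_nat_of_lt_succ fun k => ?_
    simp only [claimTime, Finset.sum_range_succ]
    linarith [hw k]
  have : {k : ℕ | claimTime w (k + 1) ≤ t} = (Finset.range n : Set ℕ) := by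
    ext k
    simp only [mem_ofPred_eq, Finset.coe_range, mem_Iio]
    constructor
    · intro h
      have := hmono.lt_iff_lt.1 (h.trans_lt h₂)
      omega
    · intro h
      exact (hmono.monotone (by omega : k + 1 ≤ n)).trans h₁
  rw [claimCount, this, Set.ncard_coe_finset, Finset.card_range]

/-- If the claim times are strictly increasing and tend to infinity, the refracted surplus solves
`dU_b = (c₁ 1_{U_b ≤ b} + c₂ 1_{U_b > b}) dt - dS`, `U_b(0) = u`, where
`S(t) = x_0 + ... + x_{N_t - 1}` is the aggregate claim amount. -/
theorem refractedSurplus_eq_integral {c₁ c₂ : ℝ} (hc₁ : 0 < c₁) (hc₂ : 0 < c₂) (b u : ℝ)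
    {w : ℕ → ℝ} (x : ℕ → ℝ) (hw : ∀ i, 0 < w i)
    (hT : Filter.Tendsto (claimTime w) Filter.atTop Filter.atTop) {t : ℝ} (ht : 0 ≤ t) :
    refractedSurplus c₁ c₂ b u w x t =
      u + (∫ s in (0 : ℝ)..t, if refractedSurplus c₁ c₂ b u w x s ≤ b then c₁ else c₂) -
        ∑ i ∈ Finset.range (claimCount w t), x i := by
  have hsucc : ∀ n, claimTime w (n + 1) = claimTime w n + w n := fun n => by
    simp [claimTime, Finset.sum_range_succ]
  have hU : ∀ n s, claimTime w n ≤ s → s < claimTime w (n + 1) →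
      refractedSurplus c₁ c₂ b u w x s =
        refractedFlow c₁ c₂ b (surplusAfterClaim c₁ c₂ b u w x n) (s - claimTime w n) := by
    intro n s h₁ h₂
    rw [refractedSurplus, claimCount_eq hw h₁ h₂]
  have hpiece : ∀ n s, claimTime w n ≤ s → s ≤ claimTime w (n + 1) →
      IntervalIntegrable (fun s => if refractedSurplus c₁ c₂ b u w x s ≤ b then c₁ else c₂)
        volume (claimTime w n) s ∧
      refractedFlow c₁ c₂ b (surplusAfterClaim c₁ c₂ b u w x n) (s - claimTime w n) =
        surplusAfterClaim c₁ c₂ b u w x n + ∫ z in (claimTime w n)..s,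
          if refractedSurplus c₁ c₂ b u w x z ≤ b then c₁ else c₂ := by
    intro n s h₁ h₂
    obtain ⟨hi, he⟩ := refractedFlow_eq_integral hc₁ hc₂ b
      (surplusAfterClaim c₁ c₂ b u w x n) (sub_nonneg.2 h₁)
    have hae : ∀ᵐ z, z ∈ uIoc (claimTime w n) s →
        (if refractedFlow c₁ c₂ b (surplusAfterClaim c₁ c₂ b u w x n) (z - claimTime w n) ≤ b
          then c₁ else c₂) = if refractedSurplus c₁ c₂ b u w x z ≤ b then c₁ else c₂ := by
      have hne : ∀ᵐ z : ℝ, z ≠ s := by simp [ae_iff]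
      filter_upwards [hne] with z hz hzm
      rw [uIoc_of_le h₁] at hzm
      rw [hU n z hzm.1.le ((lt_of_le_of_ne hzm.2 hz).trans_le h₂)]
    constructor
    · have := hi.comp_sub_right (claimTime w n)
      rw [zero_add, sub_add_cancel] at this
      exact this.congr_ae ((ae_restrict_iff' measurableSet_uIoc).2 hae)
    · rw [he, ← intervalIntegral.integral_congr_ae hae,
        intervalIntegral.integral_comp_sub_right
          (fun z => if refractedFlow c₁ c₂ b (surplusAfterClaim c₁ c₂ b u w x n) z ≤ b
            then c₁ else c₂) (claimTime w n), sub_self]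
  have hmain : ∀ n,
      IntervalIntegrable (fun s => if refractedSurplus c₁ c₂ b u w x s ≤ b then c₁ else c₂)
        volume 0 (claimTime w n) ∧
      surplusAfterClaim c₁ c₂ b u w x n = u + (∫ s in (0 : ℝ)..(claimTime w n),
        if refractedSurplus c₁ c₂ b u w x s ≤ b then c₁ else c₂) -
          ∑ i ∈ Finset.range n, x i := by
    intro n
    induction n with
    | zero => simp [claimTime, surplusAfterClaim]
    | succ n ih =>
      obtain ⟨hi, he⟩ := hpiece n (claimTime w (n + 1)) (by linarith [hsucc n, hw n]) le_rfl
      refine ⟨ih.1.trans hi, ?_⟩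
      rw [hsucc n, add_sub_cancel_left, ← hsucc n] at he
      rw [surplusAfterClaim, he, ← intervalIntegral.integral_add_adjacent_intervals ih.1 hi,
        Finset.sum_range_succ]
      linarith [ih.2]
  obtain ⟨n, hn₁, hn₂⟩ : ∃ n, claimTime w n ≤ t ∧ t < claimTime w (n + 1) := by
    have hex : ∃ n, t < claimTime w n := (hT.eventually_gt_atTop t).exists
    classical
    have hpos : Nat.find hex ≠ 0 := by
      intro h0
      have := Nat.find_spec hex
      rw [h0] at this
      simp [claimTime] at this
      linarith
    refine ⟨Nat.find hex - 1, not_lt.1 (Nat.find_min hex (by omega)), ?_⟩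
    rw [Nat.sub_add_cancel (by omega)]
    exact Nat.find_spec hex
  obtain ⟨hi, he⟩ := hpiece n t hn₁ hn₂.le
  rw [hU n t hn₁ hn₂, claimCount_eq hw hn₁ hn₂, he,
    ← intervalIntegral.integral_add_adjacent_intervals (hmain n).1 hi]
  linarith [(hmain n).2]

/-! ### The joint transform of the ruin time and the number of claims until ruin -/

/-- `φ(u) = E[r^{N_τ} e^{-δ τ} 1_{τ < ∞} | U_b(0) = u]`, for random waiting times `W` and random
claim sizes `X`. -/
def ruinTransform {Ω : Type*} [MeasurableSpace Ω] (P : Measure Ω) (W X : ℕ → Ω → ℝ)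
    (c₁ c₂ b r δ u : ℝ) : ℝ :=
  ∫ ω, (if ruinTime c₁ c₂ b u (fun i => W i ω) (fun i => X i ω) < ∞ then
      r ^ claimCount (fun i => W i ω)
          (ruinTime c₁ c₂ b u (fun i => W i ω) (fun i => X i ω)).toReal *
        Real.exp (-δ * (ruinTime c₁ c₂ b u (fun i => W i ω) (fun i => X i ω)).toReal)
    else 0) ∂P

/-! ### Analytic notions -/

/-- The translation operator `T_s f(x) = ∫_x^∞ e^{-s(y-x)} f(y) dy`. -/
def translationOp (s : ℝ) (f : ℝ → ℝ) (x : ℝ) : ℝ :=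
  ∫ y in Ioi x, Real.exp (-s * (y - x)) * f y

/-- The Laplace transform `∫_0^∞ e^{-sx} f(x) dx`. -/
def laplaceTransform (f : ℝ → ℝ) (s : ℝ) : ℝ :=
  ∫ x in Ioi (0 : ℝ), Real.exp (-s * x) * f x

/-- The tail `1 - F` of the distribution function `F(x) = ∫_{-∞}^x f(y) dy` with density `f`. -/
def tailOfDensity (f : ℝ → ℝ) (x : ℝ) : ℝ := 1 - ∫ y in Iic x, f y

/-- `ρ` is a positive root of `c s - (lam + δ) + lam r f̂(s) = 0`. -/
def IsPositiveLundbergRoot (c lam δ r : ℝ) (f : ℝ → ℝ) (ρ : ℝ) : Prop :=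
  0 < ρ ∧ c * ρ - (lam + δ) + lam * r * laplaceTransform f ρ = 0

/-- The convolution `(g * k)(t) = ∫_0^t g(x) k(t-x) dx`. -/
def halfLineConv (g k : ℝ → ℝ) (t : ℝ) : ℝ := ∫ x in (0 : ℝ)..t, g x * k (t - x)

/-- `selfConv g n` is the `(n+1)`-fold convolution `g^{(n+1)*}` of `g` with itself. -/
def selfConv (g : ℝ → ℝ) : ℕ → ℝ → ℝ
  | 0 => g
  | n + 1 => halfLineConv (selfConv g n) g

/-- `convPowConv g k n` is `g^{n*} * k`, where `g^{0*}` is the unit mass at `0`. -/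
def convPowConv (g k : ℝ → ℝ) : ℕ → ℝ → ℝ
  | 0 => k
  | n + 1 => halfLineConv (selfConv g n) k

/-- `h(y) = ∫_y^{y+b} φ(y+b-x) T_ρ f(x) dx + T_ρ F̄(y+b)`. -/
def renewalForcing (φ f : ℝ → ℝ) (b ρ y : ℝ) : ℝ :=
  (∫ x in y..(y + b), φ (y + b - x) * translationOp ρ f x) +
    translationOp ρ (tailOfDensity f) (y + b)

end

/-! ### Ruin happens at the first claim after which the surplus is negative -/

/-! The argument conditions on the first claim and then trades the exponent of the resulting
integral equation for the Lundberg root; no smoothness of φ is needed.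

Probabilistic part. The surplus does not decrease between claims, so ruin occurs exactly at the
first claim that leaves it negative. The transform restricted to ruin within the first n claims
satisfies a one-step recursion, because the path after the first claim is independent of that claim
and its waiting time and has the law of the whole path. Letting n tend to infinity gives the
first-claim equation for φ, with φ = 1 on the negative half-line (`ruinTransform_spec`).

Analytic part. Put k = λr/c₂, s = (λ+δ)/c₂ and g(y) = ∫ f(x) φ(y-x) dx. Above b the flow is linear,
so the first-claim equation reads φ = k T_s g there (`eq_mul_translationOp_of_firstClaim`). Two
identities are combined: the resolvent equation T_s g = T_ρ g - (s-ρ) T_ρ T_s g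
(`translationOp_resolvent`), and T_ρ g(u) = ∫_0^∞ φ(u-w) T_ρ f(w) dw + f̂(ρ) T_ρ φ(u)
(`translationOp_integral_mul`). Since T_ρ φ(u) = k T_ρ T_s g(u), the Lundberg equation, in the form
s-ρ = k f̂(ρ), cancels the double translates and leaves φ(u) = k ∫_0^∞ φ(u-w) T_ρ f(w) dw
(`eq_mul_integral_translationOp`). Cutting this integral at u-b and u gives the renewal equation.

Iterating the renewal equation gives the series. As 0 ≤ T_ρ f ≤ 1 and 0 ≤ φ ≤ 1, the n-th remainder
is at most (ky)^n/n! with y = u-b, so convergence does not depend on defectiveness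
(`hasSum_of_renewal`). Defectiveness and the unique root both come from the net profit condition,
through the bound f̂(s) - f̂(t) ≤ (t-s) EX for 0 ≤ s ≤ t. -/

theorem claimTime_strictMono {w : ℕ → ℝ} (hw : ∀ i, 0 < w i) : StrictMono (claimTime w) := by
  refine strictMono_nat_of_lt_succ fun k => ?_
  simp only [claimTime, Finset.sum_range_succ]
  linarith [hw k]

theorem claimTime_nonneg {w : ℕ → ℝ} (hw : ∀ i, 0 < w i) (n : ℕ) : 0 ≤ claimTime w n :=
  Finset.sum_nonneg fun i _ => (hw i).le

theorem claimTime_shift (w : ℕ → ℝ) (n : ℕ) :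
    claimTime w (n + 1) = w 0 + claimTime (fun i => w (i + 1)) n := by
  simp only [claimTime, Finset.sum_range_succ', add_comm]

theorem refractedFlow_nonneg {c₁ c₂ b v t : ℝ} (hc₁ : 0 < c₁) (hc₂ : 0 < c₂) (hb : 0 < b)
    (hv : 0 ≤ v) (ht : 0 ≤ t) : 0 ≤ refractedFlow c₁ c₂ b v t := by
  have h1 := mul_nonneg hc₁.le ht
  have h2 := mul_nonneg hc₂.le ht
  unfold refractedFlow
  split_ifs with h3 h4
  · linarith
  · linarith
  · push Not at h4
    have : (b - v) / c₁ ≤ t := by rw [div_le_iff₀ hc₁]; linarith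
    have := mul_nonneg hc₂.le (sub_nonneg.2 this)
    linarith

theorem measurable_refractedFlow (c₁ c₂ b : ℝ) :
    Measurable fun p : ℝ × ℝ => refractedFlow c₁ c₂ b p.1 p.2 := by
  unfold refractedFlow
  refine Measurable.ite (measurableSet_lt (by fun_prop) (by fun_prop)) (by fun_prop) ?_
  exact Measurable.ite (measurableSet_le (by fun_prop) (by fun_prop)) (by fun_prop) (by fun_prop)

theorem surplusAfterClaim_shift (c₁ c₂ b u : ℝ) (w x : ℕ → ℝ) (n : ℕ) :
    surplusAfterClaim c₁ c₂ b u w x (n + 1) =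
      surplusAfterClaim c₁ c₂ b (refractedFlow c₁ c₂ b u (w 0) - x 0)
        (fun i => w (i + 1)) (fun i => x (i + 1)) n := by
  induction n with
  | zero => rfl
  | succ n ih => rw [surplusAfterClaim, ih]; rfl

theorem refractedSurplus_eq_flow {c₁ c₂ b u : ℝ} {w : ℕ → ℝ} (x : ℕ → ℝ) (hw : ∀ i, 0 < w i)
    {n : ℕ} {t : ℝ} (h₁ : claimTime w n ≤ t) (h₂ : t < claimTime w (n + 1)) :
    refractedSurplus c₁ c₂ b u w x t =
      refractedFlow c₁ c₂ b (surplusAfterClaim c₁ c₂ b u w x n) (t - claimTime w n) := by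
  rw [refractedSurplus, claimCount_eq hw h₁ h₂]

theorem exists_claimTime_le_lt (w : ℕ → ℝ) {t : ℝ} (ht : 0 ≤ t) {N : ℕ} (hN : t < claimTime w N) :
    ∃ m < N, claimTime w m ≤ t ∧ t < claimTime w (m + 1) := by
  induction N with
  | zero => simp [claimTime] at hN; linarith
  | succ N ih =>
    by_cases h : t < claimTime w N
    · obtain ⟨m, hm, h'⟩ := ih h
      exact ⟨m, by omega, h'⟩
    · exact ⟨N, by omega, not_lt.1 h, hN⟩

/-- A surplus that is nonnegative after a claim stays so until the next one, which gives the lower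
bound. For the upper bound, the surplus remains negative just after the n-th claim. The case n = 0
(negative initial capital) gives τ = 0, an infimum over t > 0 that is not attained, hence the
approach from the right. -/
theorem ruinTime_eq_claimTime {c₁ c₂ b u : ℝ} (hc₁ : 0 < c₁) (hc₂ : 0 < c₂) (hb : 0 < b)
    {w : ℕ → ℝ} (x : ℕ → ℝ) (hw : ∀ i, 0 < w i) {n : ℕ}
    (hn : surplusAfterClaim c₁ c₂ b u w x n < 0)
    (hlt : ∀ m < n, 0 ≤ surplusAfterClaim c₁ c₂ b u w x m) :
    ruinTime c₁ c₂ b u w x = ENNReal.ofReal (claimTime w n) := by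
  apply le_antisymm
  · have htend : Filter.Tendsto (fun η : ℝ => ENNReal.ofReal (claimTime w n + η))
        (nhdsWithin 0 (Ioi 0)) (nhds (ENNReal.ofReal (claimTime w n))) := by
      have : Continuous fun η : ℝ => ENNReal.ofReal (claimTime w n + η) :=
        ENNReal.continuous_ofReal.comp (by fun_prop)
      simpa using (this.tendsto 0).mono_left nhdsWithin_le_nhds
    refine ge_of_tendsto htend ?_
    -- Below zero, hence below b, the surplus climbs at rate c₁; it is still negative before this
    -- time, and no further claim has occurred.
    have hsmall : 0 < min (w n) (-surplusAfterClaim c₁ c₂ b u w x n / c₁) :=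
      lt_min (hw n) (div_pos (by linarith) hc₁)
    filter_upwards [Ioo_mem_nhdsGT hsmall] with η hη
    have h1 : η < w n := hη.2.trans_le (min_le_left _ _)
    have h2 : η < -surplusAfterClaim c₁ c₂ b u w x n / c₁ := hη.2.trans_le (min_le_right _ _)
    rw [lt_div_iff₀ hc₁] at h2
    refine sInf_le ⟨claimTime w n + η, by linarith [claimTime_nonneg hw n, hη.1], ?_, rfl⟩
    have hT : claimTime w (n + 1) = claimTime w n + w n := by
      simp [claimTime, Finset.sum_range_succ]
    rw [refractedSurplus_eq_flow x hw (n := n) (by linarith [hη.1]) (by linarith),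
      add_sub_cancel_left, refractedFlow, if_neg (by linarith), if_pos (by linarith)]
    linarith
  · refine le_sInf ?_
    rintro s ⟨t, ht, hneg, rfl⟩
    refine ENNReal.ofReal_le_ofReal (not_lt.1 fun hlt' => ?_)
    obtain ⟨m, hm, h1, h2⟩ := exists_claimTime_le_lt w ht.le hlt'
    rw [refractedSurplus_eq_flow x hw h1 h2] at hneg
    linarith [refractedFlow_nonneg hc₁ hc₂ hb (hlt m hm) (sub_nonneg.2 h1)]

/-- Divergence of the claim times is what places every t between two consecutive claims. -/
theorem ruinTime_eq_top {c₁ c₂ b u : ℝ} (hc₁ : 0 < c₁) (hc₂ : 0 < c₂) (hb : 0 < b)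
    {w : ℕ → ℝ} (x : ℕ → ℝ) (hw : ∀ i, 0 < w i)
    (hT : Filter.Tendsto (claimTime w) Filter.atTop Filter.atTop)
    (h : ∀ m, 0 ≤ surplusAfterClaim c₁ c₂ b u w x m) :
    ruinTime c₁ c₂ b u w x = ∞ := by
  rw [ruinTime, sInf_eq_top]
  rintro s ⟨t, ht, hneg, rfl⟩
  obtain ⟨N, hN⟩ := (hT.eventually_gt_atTop t).exists
  obtain ⟨m, -, h1, h2⟩ := exists_claimTime_le_lt w ht.le hN
  rw [refractedSurplus_eq_flow x hw h1 h2] at hneg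
  linarith [refractedFlow_nonneg hc₁ hc₂ hb (h m) (sub_nonneg.2 h1)]

/-! ### Approximation by the transform restricted to ruin within the first `n` claims

A path is encoded by `z : ℕ ⊕ ℕ → ℝ`: `z (inl i)` are the waiting times, `z (inr i)` the claims. -/

/-- Dropping the first waiting time and the first claim. -/
def shiftPath (z : ℕ ⊕ ℕ → ℝ) : ℕ ⊕ ℕ → ℝ := fun i => z (Sum.map Nat.succ Nat.succ i)

/-- `r^{N_τ} e^{-δ τ}` if ruin happens at one of the first `n` claims (or at once), `0` if not. -/
noncomputable def truncatedDiscount (c₁ c₂ b r δ : ℝ) : ℕ → ℝ → (ℕ ⊕ ℕ → ℝ) → ℝ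
  | 0, u, _ => if u < 0 then 1 else 0
  | n + 1, u, z => if u < 0 then 1 else r * Real.exp (-δ * z (.inl 0)) *
      truncatedDiscount c₁ c₂ b r δ n
        (refractedFlow c₁ c₂ b u (z (.inl 0)) - z (.inr 0)) (shiftPath z)

theorem measurable_shiftPath : Measurable shiftPath :=
  measurable_pi_lambda _ fun _ => measurable_pi_apply _

theorem measurable_truncatedDiscount (c₁ c₂ b r δ : ℝ) (n : ℕ) :
    Measurable fun p : ℝ × (ℕ ⊕ ℕ → ℝ) => truncatedDiscount c₁ c₂ b r δ n p.1 p.2 := by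
  induction n with
  | zero =>
    exact Measurable.ite (measurableSet_lt measurable_fst measurable_const) measurable_const
      measurable_const
  | succ n ih =>
    have h0 : ∀ i : ℕ ⊕ ℕ, Measurable fun p : ℝ × (ℕ ⊕ ℕ → ℝ) => p.2 i := fun i =>
      (measurable_pi_apply i).comp measurable_snd
    refine Measurable.ite (measurableSet_lt measurable_fst measurable_const) measurable_const ?_
    refine Measurable.mul ((measurable_const.mul (((h0 _).const_mul _).exp))) ?_
    exact ih.comp ((((measurable_refractedFlow c₁ c₂ b).comp
      (measurable_fst.prodMk (h0 (.inl 0)))).sub (h0 (.inr 0))).prodMk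
        (measurable_shiftPath.comp measurable_snd))

theorem truncatedDiscount_mem_Icc {c₁ c₂ b r δ : ℝ} (hr : 0 < r) (hr1 : r ≤ 1) (hδ : 0 < δ)
    (n : ℕ) (u : ℝ) {z : ℕ ⊕ ℕ → ℝ} (hz : ∀ i, 0 < z (.inl i)) :
    truncatedDiscount c₁ c₂ b r δ n u z ∈ Icc (0 : ℝ) 1 := by
  induction n generalizing u z with
  | zero => simp only [truncatedDiscount]; split_ifs <;> simp
  | succ n ih =>
    simp only [truncatedDiscount]
    split_ifs
    · simp
    · obtain ⟨h0, h1⟩ := ih (refractedFlow c₁ c₂ b u (z (.inl 0)) - z (.inr 0))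
        (z := shiftPath z) fun i => hz (i + 1)
      have he : Real.exp (-δ * z (.inl 0)) ≤ 1 := by
        rw [Real.exp_le_one_iff]; nlinarith [hz 0]
      have he0 := (Real.exp_pos (-δ * z (.inl 0))).le
      exact ⟨by positivity, mul_le_one₀ (mul_le_one₀ hr1 he0 he) h0 h1⟩

theorem truncatedDiscount_eq_zero {c₁ c₂ b r δ : ℝ} {n : ℕ} {u : ℝ} {z : ℕ ⊕ ℕ → ℝ}
    (h : ∀ m ≤ n, 0 ≤ surplusAfterClaim c₁ c₂ b u (fun i => z (.inl i)) (fun i => z (.inr i)) m) :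
    truncatedDiscount c₁ c₂ b r δ n u z = 0 := by
  induction n generalizing u z with
  | zero => exact if_neg (not_lt.2 (h 0 le_rfl))
  | succ n ih =>
    have hu : 0 ≤ u := h 0 (by omega)
    rw [truncatedDiscount, if_neg (not_lt.2 hu), ih, mul_zero]
    intro m hm
    have := h (m + 1) (by omega)
    rwa [surplusAfterClaim_shift] at this

theorem truncatedDiscount_eq {c₁ c₂ b r δ : ℝ} {m n : ℕ} (hmn : m ≤ n) {u : ℝ} {z : ℕ ⊕ ℕ → ℝ}
    (hm : surplusAfterClaim c₁ c₂ b u (fun i => z (.inl i)) (fun i => z (.inr i)) m < 0)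
    (hlt : ∀ k < m,
      0 ≤ surplusAfterClaim c₁ c₂ b u (fun i => z (.inl i)) (fun i => z (.inr i)) k) :
    truncatedDiscount c₁ c₂ b r δ n u z =
      r ^ m * Real.exp (-δ * claimTime (fun i => z (.inl i)) m) := by
  induction n generalizing u z m with
  | zero =>
    obtain rfl : m = 0 := by omega
    have hu : u < 0 := hm
    rw [truncatedDiscount, if_pos hu]
    simp [claimTime]
  | succ n ih =>
    cases m with
    | zero =>
      have hu : u < 0 := hm
      rw [truncatedDiscount, if_pos hu]
      simp [claimTime]
    | succ m =>
      have hu : 0 ≤ u := hlt 0 (by omega)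
      rw [truncatedDiscount, if_neg (not_lt.2 hu), ih (m := m) (by omega),
        claimTime_shift, mul_add, Real.exp_add, pow_succ]
      · simp only [shiftPath, Sum.map_inl, Nat.succ_eq_add_one]
        ring
      · rw [surplusAfterClaim_shift] at hm
        exact hm
      · intro k hk
        have := hlt (k + 1) (by omega)
        rwa [surplusAfterClaim_shift] at this

/-- The integrand of `ruinTransform` along the path `z`. -/
noncomputable def ruinDiscount (c₁ c₂ b r δ u : ℝ) (z : ℕ ⊕ ℕ → ℝ) : ℝ :=
  if ruinTime c₁ c₂ b u (fun i => z (.inl i)) (fun i => z (.inr i)) < ∞ then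
    r ^ claimCount (fun i => z (.inl i))
        (ruinTime c₁ c₂ b u (fun i => z (.inl i)) (fun i => z (.inr i))).toReal *
      Real.exp (-δ * (ruinTime c₁ c₂ b u (fun i => z (.inl i)) (fun i => z (.inr i))).toReal)
  else 0

/-- Along a single path the sequence is eventually constant if ruin occurs and identically zero
otherwise. -/
theorem tendsto_truncatedDiscount {c₁ c₂ b r δ u : ℝ} (hc₁ : 0 < c₁) (hc₂ : 0 < c₂) (hb : 0 < b)
    {z : ℕ ⊕ ℕ → ℝ} (hw : ∀ i, 0 < z (.inl i))
    (hT : Filter.Tendsto (claimTime fun i => z (.inl i)) Filter.atTop Filter.atTop) :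
    Filter.Tendsto (fun n => truncatedDiscount c₁ c₂ b r δ n u z) Filter.atTop
      (nhds (ruinDiscount c₁ c₂ b r δ u z)) := by
  classical
  by_cases h : ∃ m,
      surplusAfterClaim c₁ c₂ b u (fun i => z (.inl i)) (fun i => z (.inr i)) m < 0
  · have hlt := fun k (hk : k < Nat.find h) => not_lt.1 (Nat.find_min h hk)
    have hτ := ruinTime_eq_claimTime hc₁ hc₂ hb _ hw (Nat.find_spec h) hlt
    -- The counting process is right-continuous, so the ruinous claim is itself counted in N_τ.
    have hcount := claimCount_eq hw le_rfl (claimTime_strictMono hw (Nat.lt_succ_self (Nat.find h)))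
    refine tendsto_const_nhds.congr' ?_
    filter_upwards [Filter.eventually_ge_atTop (Nat.find h)] with n hn
    rw [truncatedDiscount_eq hn (Nat.find_spec h) hlt, ruinDiscount, hτ,
      if_pos ENNReal.ofReal_lt_top, ENNReal.toReal_ofReal (claimTime_nonneg hw _), hcount]
  · push Not at h
    rw [ruinDiscount, ruinTime_eq_top hc₁ hc₂ hb _ hw hT h]
    simp only [lt_self_iff_false, if_false]
    refine tendsto_const_nhds.congr fun n => ?_
    rw [truncatedDiscount_eq_zero fun m _ => h m]

/-! ### The law of the path of waiting times and claims -/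

section PathLaw

variable {Ω : Type*} [MeasurableSpace Ω] {P : Measure Ω} {Z : ℕ ⊕ ℕ → Ω → ℝ}

/-- Both laws are infinite products, and the injective shift of indices preserves every marginal. -/
theorem map_shiftPath_eq (hZ : ∀ i, Measurable (Z i)) (hindep : iIndepFun Z P)
    (hident : ∀ i, P.map (Z (Sum.map Nat.succ Nat.succ i)) = P.map (Z i)) :
    P.map (fun ω => shiftPath fun i => Z i ω) = P.map fun ω i => Z i ω := by
  have hinj : Function.Injective (Sum.map Nat.succ Nat.succ) :=
    Nat.succ_injective.sumMap Nat.succ_injective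
  have h := (hindep.precomp hinj).map_fun_eq_infinitePi_map fun i => hZ _
  rw [hindep.map_fun_eq_infinitePi_map hZ]
  simp only [hident] at h
  exact h

variable [IsProbabilityMeasure P]

/-- The first waiting time and claim use indices disjoint from those of the shifted path, so the
σ-algebras they generate are independent. -/
theorem map_first_prod_shiftPath (hZ : ∀ i, Measurable (Z i)) (hindep : iIndepFun Z P) :
    P.map (fun ω => ((Z (.inl 0) ω, Z (.inr 0) ω), shiftPath fun i => Z i ω)) =
      ((P.map (Z (.inl 0))).prod (P.map (Z (.inr 0)))).prod
        (P.map fun ω => shiftPath fun i => Z i ω) := by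
  have hshift : Measurable fun ω => shiftPath fun i => Z i ω :=
    measurable_shiftPath.comp (measurable_pi_lambda _ hZ)
  have h1 : IndepFun (Z (.inl 0)) (Z (.inr 0)) P := hindep.indepFun (by simp)
  have h2 : IndepFun (fun ω => (Z (.inl 0) ω, Z (.inr 0) ω))
      (fun ω => shiftPath fun i => Z i ω) P := by
    have hdisj : Disjoint ({.inl 0, .inr 0} : Set (ℕ ⊕ ℕ))
        (Set.range (Sum.map Nat.succ Nat.succ)) := by
      rw [Set.disjoint_left]
      rintro _ (rfl | rfl) ⟨i | i, hi⟩ <;> simp at hi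
    have hle : ∀ (S : Set (ℕ ⊕ ℕ)), ∀ i ∈ S,
        Measurable[⨆ i ∈ S, MeasurableSpace.comap (Z i) inferInstance] (Z i) := fun S i hi =>
      (measurable_iff_comap_le.2 (le_iSup₂_of_le i hi le_rfl))
    refine indep_of_indep_of_le_left (indep_of_indep_of_le_right (indep_iSup_of_disjoint
      (fun i => (hZ i).comap_le) hindep hdisj) ?_) ?_
    · rw [← measurable_iff_comap_le]
      exact @measurable_pi_lambda _ _ _ (_) _ _ fun i => hle _ _ ⟨i, rfl⟩
    · rw [← measurable_iff_comap_le]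
      exact (hle _ _ (by simp)).prodMk (hle _ _ (by simp))
  rw [h2.map_prod_eq_prod_map_map ((hZ _).prodMk (hZ _)).aemeasurable hshift.aemeasurable,
    h1.map_prod_eq_prod_map_map (hZ _).aemeasurable (hZ _).aemeasurable]

/-- Sums of positive i.i.d. random variables tend to infinity. -/
theorem ae_tendsto_claimTime {W : ℕ → Ω → ℝ} (hW : ∀ i, Measurable (W i))
    (hindep : iIndepFun W P) (hident : ∀ i, P.map (W i) = P.map (W 0))
    (hpos : ∀ᵐ ω ∂P, ∀ i, 0 < W i ω) :
    ∀ᵐ ω ∂P, Filter.Tendsto (claimTime fun i => W i ω) Filter.atTop Filter.atTop := by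
  -- Truncation at 1 makes the strong law available without a moment assumption, keeps the mean
  -- positive, and only lowers the partial sums.
  have hmin : Measurable fun x : ℝ => min x 1 := by fun_prop
  have hbd : ∀ᵐ ω ∂P, ‖min (W 0 ω) 1‖ ≤ 1 := by
    filter_upwards [hpos] with ω h
    rw [Real.norm_of_nonneg (le_min (h 0).le zero_le_one)]
    exact min_le_right _ _
  have hint : Integrable (fun ω => min (W 0 ω) 1) P :=
    Integrable.of_bound (hmin.comp (hW 0)).aestronglyMeasurable 1 hbd
  have hmean : 0 < ∫ ω, min (W 0 ω) 1 ∂P := by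
    rw [integral_pos_iff_support_of_nonneg_ae _ hint]
    · have : ∀ᵐ ω ∂P, ω ∈ Function.support fun ω => min (W 0 ω) 1 := by
        filter_upwards [hpos] with ω h
        exact (lt_min (h 0) one_pos).ne'
      refine pos_iff_ne_zero.2 fun h0 => ?_
      obtain ⟨ω, h1, h2⟩ := (this.and (measure_eq_zero_iff_ae_notMem.1 h0)).exists
      exact h2 h1
    · filter_upwards [hpos] with ω h
      exact le_min (h 0).le zero_le_one
  have hlaw := strong_law_ae_real (μ := P) (fun i ω => min (W i ω) 1) hint
    (fun i j hij => (hindep.indepFun hij).comp hmin hmin)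
    (fun i => (IdentDistrib.mk (hW i).aemeasurable (hW 0).aemeasurable (hident i)).comp hmin)
  filter_upwards [hlaw] with ω hω
  have h1 : Filter.Tendsto (fun n : ℕ => ∑ i ∈ Finset.range n, min (W i ω) 1)
      Filter.atTop Filter.atTop := by
    refine (hω.pos_mul_atTop hmean tendsto_natCast_atTop_atTop).congr' ?_
    filter_upwards [Filter.eventually_gt_atTop 0] with n hn
    have : (n : ℝ) ≠ 0 := by positivity
    field_simp
  refine Filter.tendsto_atTop_mono (fun n => ?_) h1
  exact Finset.sum_le_sum fun i _ => min_le_left _ _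

end PathLaw

/-! ### Integration against the exponential law and against a density -/

theorem ae_pos_expMeasure {lam : ℝ} : ∀ᵐ t ∂(expMeasure lam), 0 < t := by
  have hle : (Iic (0 : ℝ))ᶜ ∈ ae (expMeasure lam) := by
    rw [compl_mem_ae_iff, expMeasure, gammaMeasure, withDensity_apply _ measurableSet_Iic,
      ← setLIntegral_congr Iio_ae_eq_Iic]
    exact lintegral_gammaPDF_of_nonpos le_rfl
  filter_upwards [hle] with t ht
  simpa using ht

theorem integral_expMeasure {lam : ℝ} (hlam : 0 < lam) (g : ℝ → ℝ) :
    ∫ t, g t ∂(expMeasure lam) = ∫ t in Ioi (0 : ℝ), lam * Real.exp (-lam * t) * g t := by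
  have h : expMeasure lam = volume.withDensity (exponentialPDF lam) := rfl
  rw [h, integral_withDensity_eq_integral_toReal_smul
    (f := exponentialPDF lam) (measurable_exponentialPDFReal lam).ennreal_ofReal
    (by simp [exponentialPDF]),
    ← integral_indicator measurableSet_Ioi]
  refine integral_congr_ae ?_
  have hne : ∀ᵐ z : ℝ, z ≠ 0 := by simp [ae_iff]
  filter_upwards [hne] with t ht
  rcases lt_or_gt_of_ne ht with h | h
  · simp [exponentialPDF_of_neg h, not_lt.2 h.le]
  · rw [exponentialPDF_of_nonneg h.le, ENNReal.toReal_ofReal (by positivity),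
      indicator_of_mem (mem_Ioi.2 h), smul_eq_mul, neg_mul]

theorem integral_withDensity_ofReal {f : ℝ → ℝ} (hf : Measurable f) (hf0 : ∀ x, 0 ≤ f x)
    (g : ℝ → ℝ) :
    ∫ x, g x ∂(volume.withDensity fun x => ENNReal.ofReal (f x)) = ∫ x, f x * g x := by
  rw [integral_withDensity_eq_integral_toReal_smul hf.ennreal_ofReal (by simp)]
  simp [hf0]

/-! ### The ruin transform: measurability and conditioning on the first claim -/

section RuinTransform

variable {Ω : Type*} [MeasurableSpace Ω] {P : Measure Ω} [IsProbabilityMeasure P]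
  {Z : ℕ ⊕ ℕ → Ω → ℝ} {c₁ c₂ b r δ : ℝ}

theorem integrable_of_mem_Icc {α : Type*} [MeasurableSpace α] {μ : Measure α} [IsFiniteMeasure μ]
    {g : α → ℝ} (hg : AEStronglyMeasurable g μ) (h : ∀ᵐ x ∂μ, g x ∈ Icc (0 : ℝ) 1) :
    Integrable g μ :=
  Integrable.of_bound hg 1 (h.mono fun _ hx => by rw [Real.norm_of_nonneg hx.1]; exact hx.2)

theorem measurable_integral_truncatedDiscount (hZ : ∀ i, Measurable (Z i)) (n : ℕ) :
    Measurable fun u => ∫ ω, truncatedDiscount c₁ c₂ b r δ n u (fun i => Z i ω) ∂P := by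
  have h : Measurable fun p : ℝ × Ω => truncatedDiscount c₁ c₂ b r δ n p.1 (fun i => Z i p.2) :=
    (measurable_truncatedDiscount c₁ c₂ b r δ n).comp (measurable_fst.prodMk
      ((measurable_pi_lambda _ hZ).comp measurable_snd))
  exact h.stronglyMeasurable.integral_prod_right.measurable

theorem integral_truncatedDiscount_mem_Icc (hr : 0 < r) (hr1 : r ≤ 1) (hδ : 0 < δ)
    (hpos : ∀ᵐ ω ∂P, ∀ i, 0 < Z (.inl i) ω) (n : ℕ) (u : ℝ) :
    ∫ ω, truncatedDiscount c₁ c₂ b r δ n u (fun i => Z i ω) ∂P ∈ Icc (0 : ℝ) 1 := by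
  have h := hpos.mono fun ω hω => truncatedDiscount_mem_Icc (c₁ := c₁) (c₂ := c₂) (b := b)
    hr hr1 hδ n u (z := fun i => Z i ω) hω
  refine ⟨integral_nonneg_of_ae (h.mono fun ω hω => hω.1), ?_⟩
  calc _ ≤ ∫ ω, (1 : ℝ) ∂P := integral_mono_of_nonneg (h.mono fun ω hω => hω.1)
        (integrable_const _) (h.mono fun ω hω => hω.2)
    _ = 1 := by simp

/-- The renewal property at the first claim: what follows is an independent copy of the whole path,
started from the surplus left by that claim. -/
theorem integral_truncatedDiscount_succ (hr : 0 < r) (hr1 : r ≤ 1) (hδ : 0 < δ)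
    (hZ : ∀ i, Measurable (Z i)) (hindep : iIndepFun Z P)
    (hident : ∀ i, P.map (Z (Sum.map Nat.succ Nat.succ i)) = P.map (Z i))
    (hpos : ∀ᵐ ω ∂P, ∀ i, 0 < Z (.inl i) ω) (n : ℕ) {u : ℝ} (hu : 0 ≤ u) :
    ∫ ω, truncatedDiscount c₁ c₂ b r δ (n + 1) u (fun i => Z i ω) ∂P =
      ∫ p, r * Real.exp (-δ * p.1) *
        (∫ ω, truncatedDiscount c₁ c₂ b r δ n (refractedFlow c₁ c₂ b u p.1 - p.2)
          (fun i => Z i ω) ∂P) ∂((P.map (Z (.inl 0))).prod (P.map (Z (.inr 0)))) := by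
  have hZm : Measurable fun ω i => Z i ω := measurable_pi_lambda _ hZ
  have hshift : Measurable fun ω => shiftPath fun i => Z i ω := measurable_shiftPath.comp hZm
  have : ∀ i, IsProbabilityMeasure (P.map (Z i)) := fun i =>
    Measure.isProbabilityMeasure_map (hZ i).aemeasurable
  have : IsProbabilityMeasure (P.map fun ω i => Z i ω) :=
    Measure.isProbabilityMeasure_map hZm.aemeasurable
  set K : (ℝ × ℝ) × (ℕ ⊕ ℕ → ℝ) → ℝ := fun q => r * Real.exp (-δ * q.1.1) *
    truncatedDiscount c₁ c₂ b r δ n (refractedFlow c₁ c₂ b u q.1.1 - q.1.2) q.2 with hK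
  have hKm : Measurable K := by
    have hflow : Measurable fun q : (ℝ × ℝ) × (ℕ ⊕ ℕ → ℝ) =>
        refractedFlow c₁ c₂ b u q.1.1 - q.1.2 :=
      ((measurable_refractedFlow c₁ c₂ b).comp
        (measurable_const.prodMk (measurable_fst.comp measurable_fst))).sub
        (measurable_snd.comp measurable_fst)
    have := (measurable_truncatedDiscount c₁ c₂ b r δ n).comp (hflow.prodMk measurable_snd)
    exact (by fun_prop : Measurable fun q : (ℝ × ℝ) × (ℕ ⊕ ℕ → ℝ) =>
      r * Real.exp (-δ * q.1.1)).mul this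
  have hfirst : Measurable fun ω =>
      ((Z (.inl 0) ω, Z (.inr 0) ω), shiftPath fun i => Z i ω) :=
    ((hZ _).prodMk (hZ _)).prodMk hshift
  have heq : ∀ ω, truncatedDiscount c₁ c₂ b r δ (n + 1) u (fun i => Z i ω) =
      K ((Z (.inl 0) ω, Z (.inr 0) ω), shiftPath fun i => Z i ω) := fun ω => by
    rw [truncatedDiscount, if_neg (not_lt.2 hu)]
  have hlaw := map_first_prod_shiftPath hZ hindep
  -- Along the actual path K is the truncated discount for n + 1 claims, which lies in [0, 1].
  have hint : Integrable K (P.map fun ω =>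
      ((Z (.inl 0) ω, Z (.inr 0) ω), shiftPath fun i => Z i ω)) := by
    rw [integrable_map_measure hKm.aestronglyMeasurable hfirst.aemeasurable]
    refine integrable_of_mem_Icc (hKm.comp hfirst).aestronglyMeasurable ?_
    filter_upwards [hpos] with ω hω
    have := truncatedDiscount_mem_Icc (c₁ := c₁) (c₂ := c₂) (b := b) hr hr1 hδ (n + 1) u
      (z := fun i => Z i ω) hω
    rwa [heq] at this
  simp_rw [heq]
  rw [← integral_map hfirst.aemeasurable hKm.aestronglyMeasurable]
  rw [hlaw, map_shiftPath_eq hZ hindep hident] at hint ⊢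
  rw [integral_prod _ hint]
  refine integral_congr_ae (Filter.Eventually.of_forall fun p => ?_)
  simp only [hK]
  rw [integral_const_mul, integral_map hZm.aemeasurable]
  exact ((measurable_truncatedDiscount c₁ c₂ b r δ n).comp
    measurable_prodMk_left).aestronglyMeasurable

theorem tendsto_integral_truncatedDiscount (hc₁ : 0 < c₁) (hc₂ : 0 < c₂) (hb : 0 < b)
    (hr : 0 < r) (hr1 : r ≤ 1) (hδ : 0 < δ) (hZ : ∀ i, Measurable (Z i))
    (hpos : ∀ᵐ ω ∂P, ∀ i, 0 < Z (.inl i) ω)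
    (hT : ∀ᵐ ω ∂P, Filter.Tendsto (claimTime fun i => Z (.inl i) ω) Filter.atTop Filter.atTop)
    (u : ℝ) :
    Filter.Tendsto (fun n => ∫ ω, truncatedDiscount c₁ c₂ b r δ n u (fun i => Z i ω) ∂P)
      Filter.atTop (nhds (∫ ω, ruinDiscount c₁ c₂ b r δ u (fun i => Z i ω) ∂P)) := by
  refine tendsto_integral_of_dominated_convergence (fun _ => 1) (fun n => ?_)
    (integrable_const _) (fun n => ?_) ?_
  · exact ((measurable_truncatedDiscount c₁ c₂ b r δ n).comp
      (measurable_const.prodMk (measurable_pi_lambda _ hZ))).aestronglyMeasurable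
  · filter_upwards [hpos] with ω hω
    have := truncatedDiscount_mem_Icc (c₁ := c₁) (c₂ := c₂) (b := b) hr hr1 hδ n u
      (z := fun i => Z i ω) hω
    rw [Real.norm_of_nonneg this.1]
    exact this.2
  · filter_upwards [hpos, hT] with ω h1 h2
    exact tendsto_truncatedDiscount hc₁ hc₂ hb h1 h2

end RuinTransform

/-- The properties of `φ = ruinTransform` that the renewal argument uses: `φ` is measurable,
`0 ≤ φ ≤ 1`, `φ = 1` on the negative half-line, and the equation obtained by conditioning on the
first claim. -/
theorem ruinTransform_spec {Ω : Type*} [MeasurableSpace Ω] {P : Measure Ω}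
    [IsProbabilityMeasure P] {c₁ c₂ b lam r δ : ℝ} {f : ℝ → ℝ} {W X : ℕ → Ω → ℝ}
    (hc₁ : 0 < c₁) (hc₂ : 0 < c₂) (hb : 0 < b)
    (hr : 0 < r) (hr1 : r ≤ 1) (hδ : 0 < δ)
    (hX_meas : ∀ i, Measurable (X i))
    (hX_law : ∀ i, P.map (X i) = volume.withDensity (fun x => ENNReal.ofReal (f x)))
    (hW_meas : ∀ i, Measurable (W i)) (hW_law : ∀ i, P.map (W i) = expMeasure lam)
    (hindep : iIndepFun (Sum.elim W X) P) :
    Measurable (ruinTransform P W X c₁ c₂ b r δ) ∧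
    (∀ u, ruinTransform P W X c₁ c₂ b r δ u ∈ Icc (0 : ℝ) 1) ∧
    (∀ u < 0, ruinTransform P W X c₁ c₂ b r δ u = 1) ∧
    ∀ u, 0 ≤ u → ruinTransform P W X c₁ c₂ b r δ u =
      ∫ t, ∫ x, r * Real.exp (-δ * t) *
        ruinTransform P W X c₁ c₂ b r δ (refractedFlow c₁ c₂ b u t - x)
          ∂(volume.withDensity (fun x => ENNReal.ofReal (f x))) ∂(expMeasure lam) := by
  set Z := Sum.elim W X with hZdef
  have hZ : ∀ i, Measurable (Z i) := by rintro (i | i); exacts [hW_meas i, hX_meas i]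
  have hident : ∀ i, P.map (Z (Sum.map Nat.succ Nat.succ i)) = P.map (Z i) := by
    rintro (i | i)
    · exact (hW_law _).trans (hW_law _).symm
    · exact (hX_law _).trans (hX_law _).symm
  have hpos : ∀ᵐ ω ∂P, ∀ i, 0 < Z (.inl i) ω := by
    rw [ae_all_iff]
    intro i
    have := ae_pos_expMeasure (lam := lam)
    rw [← hW_law i] at this
    exact ae_of_ae_map (hW_meas i).aemeasurable this
  have hT : ∀ᵐ ω ∂P,
      Filter.Tendsto (claimTime fun i => Z (.inl i) ω) Filter.atTop Filter.atTop :=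
    ae_tendsto_claimTime hW_meas (hindep.precomp Sum.inl_injective)
      (fun i => (hW_law i).trans (hW_law 0).symm) hpos
  have hlim : ∀ u, Filter.Tendsto
      (fun n => ∫ ω, truncatedDiscount c₁ c₂ b r δ n u (fun i => Z i ω) ∂P)
      Filter.atTop (nhds (ruinTransform P W X c₁ c₂ b r δ u)) := fun u =>
    tendsto_integral_truncatedDiscount hc₁ hc₂ hb hr hr1 hδ hZ hpos hT u
  have hmem : ∀ n u, ∫ ω, truncatedDiscount c₁ c₂ b r δ n u (fun i => Z i ω) ∂P ∈ Icc (0 : ℝ) 1 :=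
    integral_truncatedDiscount_mem_Icc hr hr1 hδ hpos
  have hmeas : Measurable (ruinTransform P W X c₁ c₂ b r δ) :=
    measurable_of_tendsto_metrizable (fun n => measurable_integral_truncatedDiscount hZ n)
      (tendsto_pi_nhds.2 hlim)
  have hIcc : ∀ u, ruinTransform P W X c₁ c₂ b r δ u ∈ Icc (0 : ℝ) 1 := fun u =>
    isClosed_Icc.mem_of_tendsto (hlim u) (Filter.Eventually.of_forall fun n => hmem n u)
  refine ⟨hmeas, hIcc, fun u hu => ?_, fun u hu => ?_⟩
  · refine tendsto_nhds_unique (hlim u) (tendsto_const_nhds.congr fun n => ?_)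
    cases n <;> simp [truncatedDiscount, hu]
  · have : ∀ i, IsProbabilityMeasure (P.map (Z i)) := fun i =>
      Measure.isProbabilityMeasure_map (hZ i).aemeasurable
    have hW0 : P.map (Z (.inl 0)) = expMeasure lam := hW_law 0
    have hX0 : P.map (Z (.inr 0)) = volume.withDensity (fun x => ENNReal.ofReal (f x)) := hX_law 0
    have hflow : Measurable fun p : ℝ × ℝ => refractedFlow c₁ c₂ b u p.1 - p.2 :=
      ((measurable_refractedFlow c₁ c₂ b).comp (measurable_const.prodMk measurable_fst)).sub
        measurable_snd
    have hfac : Measurable fun p : ℝ × ℝ => r * Real.exp (-δ * p.1) := by fun_prop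
    have hbound : ∀ (g : ℝ → ℝ), (∀ v, g v ∈ Icc (0 : ℝ) 1) →
        ∀ᵐ p ∂((P.map (Z (.inl 0))).prod (P.map (Z (.inr 0)))),
          r * Real.exp (-δ * p.1) * g (refractedFlow c₁ c₂ b u p.1 - p.2) ∈ Icc (0 : ℝ) 1 := by
      intro g hg
      have h1 : ∀ᵐ p ∂((P.map (Z (.inl 0))).prod (P.map (Z (.inr 0)))), (0 : ℝ) < p.1 := by
        refine Measure.quasiMeasurePreserving_fst.ae (p := fun t : ℝ => 0 < t) ?_
        rw [hW0]
        exact ae_pos_expMeasure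
      filter_upwards [h1] with p hp
      have he : Real.exp (-δ * p.1) ≤ 1 := by
        rw [Real.exp_le_one_iff]; nlinarith
      have he0 := (Real.exp_pos (-δ * p.1)).le
      obtain ⟨h0, h1⟩ := hg (refractedFlow c₁ c₂ b u p.1 - p.2)
      exact ⟨by positivity, mul_le_one₀ (mul_le_one₀ hr1 he0 he) h0 h1⟩
    -- Both sides of the recursion converge, the right one by dominated convergence with bound 1, so
    -- the limits agree.
    have hrec := tendsto_nhds_unique ((hlim u).comp (Filter.tendsto_add_atTop_nat 1))
      ((tendsto_integral_of_dominated_convergence (fun _ => (1 : ℝ))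
        (μ := (P.map (Z (.inl 0))).prod (P.map (Z (.inr 0))))
        (F := fun n p => r * Real.exp (-δ * p.1) *
          (∫ ω, truncatedDiscount c₁ c₂ b r δ n (refractedFlow c₁ c₂ b u p.1 - p.2)
            (fun i => Z i ω) ∂P))
        (f := fun p => r * Real.exp (-δ * p.1) *
          ruinTransform P W X c₁ c₂ b r δ (refractedFlow c₁ c₂ b u p.1 - p.2))
        (fun n => (hfac.mul
          ((measurable_integral_truncatedDiscount hZ n).comp hflow)).aestronglyMeasurable)
        (integrable_const _)
        (fun n => (hbound _ (hmem n)).mono fun p hp => by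
          rw [Real.norm_of_nonneg hp.1]; exact hp.2)
        (Filter.Eventually.of_forall fun p => (hlim _).const_mul _)).congr fun n =>
          (integral_truncatedDiscount_succ hr hr1 hδ hZ hindep hident hpos n hu).symm)
    have hint : Integrable (fun p : ℝ × ℝ => r * Real.exp (-δ * p.1) *
        ruinTransform P W X c₁ c₂ b r δ (refractedFlow c₁ c₂ b u p.1 - p.2))
        ((P.map (Z (.inl 0))).prod (P.map (Z (.inr 0)))) :=
      integrable_of_mem_Icc (hfac.mul (hmeas.comp hflow)).aestronglyMeasurable (hbound _ hIcc)
    rw [hrec, integral_prod _ hint, hW0, hX0]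

/-! ### The translation operator as convolution with an exponential kernel -/

/-- The function `v ↦ e^{-sv} 1_{v > 0}`. -/
noncomputable def expKernel (s : ℝ) : ℝ → ℝ := (Ioi 0).indicator fun v => Real.exp (-s * v)

theorem expKernel_of_pos (s : ℝ) {v : ℝ} (hv : 0 < v) : expKernel s v = Real.exp (-s * v) :=
  indicator_of_mem (mem_Ioi.2 hv) _

theorem expKernel_of_nonpos (s : ℝ) {v : ℝ} (hv : v ≤ 0) : expKernel s v = 0 :=
  indicator_of_notMem (by simpa using hv) _

theorem expKernel_nonneg (s v : ℝ) : 0 ≤ expKernel s v :=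
  indicator_nonneg (fun _ _ => (Real.exp_pos _).le) _

theorem expKernel_le_one {s : ℝ} (hs : 0 ≤ s) (v : ℝ) : expKernel s v ≤ 1 := by
  refine indicator_le' (fun v hv => ?_) (fun _ _ => zero_le_one) v
  rw [Real.exp_le_one_iff]
  nlinarith [mem_Ioi.1 hv]

theorem measurable_expKernel (s : ℝ) : Measurable (expKernel s) :=
  Measurable.indicator (by fun_prop) measurableSet_Ioi

theorem integrable_expKernel {s : ℝ} (hs : 0 < s) : Integrable (expKernel s) :=
  (integrable_indicator_iff measurableSet_Ioi).2 (exp_neg_integrableOn_Ioi 0 hs)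

theorem integral_expKernel {s : ℝ} (hs : 0 < s) : ∫ v, expKernel s v = 1 / s := by
  rw [expKernel, integral_indicator measurableSet_Ioi, integral_exp_mul_Ioi (by linarith)]
  simp

theorem integral_expKernel_mul (s : ℝ) (g : ℝ → ℝ) :
    ∫ v, expKernel s v * g v = ∫ v in Ioi 0, Real.exp (-s * v) * g v := by
  rw [← integral_indicator measurableSet_Ioi]
  congr 1 with v
  simp only [expKernel, indicator]
  split_ifs <;> simp

/-- Writing the operator over the whole line makes translation invariance and Fubini available
without tracking the limits of integration. -/
theorem translationOp_eq (s : ℝ) (g : ℝ → ℝ) (x : ℝ) :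
    translationOp s g x = ∫ v, expKernel s v * g (x + v) := by
  rw [translationOp, ← integral_indicator measurableSet_Ioi, ← integral_add_left_eq_self _ x]
  congr 1 with v
  by_cases hv : 0 < v
  · rw [expKernel_of_pos s hv, indicator_of_mem (by simpa using hv)]
    simp
  · rw [expKernel_of_nonpos s (not_lt.1 hv), indicator_of_notMem (by simpa using hv), zero_mul]

/-- The shear (x, y) ↦ (x, x + y) preserves Lebesgue measure on the plane. -/
theorem Integrable.mul_comp_add {K L : ℝ → ℝ} (hK : Integrable K) (hL : Integrable L) :
    Integrable (fun p : ℝ × ℝ => K p.1 * L (p.1 + p.2)) (volume.prod volume) :=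
  (measurePreserving_prod_add volume volume).integrable_comp_of_integrable (hK.mul_prod hL)

theorem Integrable.mul_comp_sub {K L : ℝ → ℝ} (hK : Integrable K) (hL : Integrable L) :
    Integrable (fun p : ℝ × ℝ => K p.1 * L (p.2 - p.1)) (volume.prod volume) := by
  have := (measurePreserving_prod_neg_add (volume : Measure ℝ)
    (volume : Measure ℝ)).integrable_comp_of_integrable (hK.mul_prod hL)
  simpa only [Function.comp_def, neg_add_eq_sub] using this

/-- On (0, y) the integrand e^{-ρv - s(y-v)} has derivative s - ρ times itself. Keeping that factor
on the left avoids a separate case s = ρ. -/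
theorem integral_expKernel_mul_expKernel (s ρ y : ℝ) :
    (s - ρ) * ∫ v, expKernel ρ v * expKernel s (y - v) = expKernel ρ y - expKernel s y := by
  by_cases hy : 0 < y
  · have h1 : (fun v => expKernel ρ v * expKernel s (y - v)) =
        (Ioo 0 y).indicator fun v => Real.exp (-ρ * v + -s * (y - v)) := by
      ext v
      by_cases h0 : 0 < v
      · by_cases h2 : v < y
        · rw [indicator_of_mem (show v ∈ Ioo 0 y from ⟨h0, h2⟩), expKernel_of_pos _ h0,
            expKernel_of_pos _ (by linarith),
            Real.exp_add]
        · rw [indicator_of_notMem fun h => h2 h.2, expKernel_of_nonpos s (by linarith), mul_zero]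
      · rw [indicator_of_notMem fun h => h0 h.1, expKernel_of_nonpos ρ (by linarith), zero_mul]
    rw [h1, integral_indicator measurableSet_Ioo, ← integral_Ioc_eq_integral_Ioo,
      ← intervalIntegral.integral_of_le hy.le, ← intervalIntegral.integral_const_mul,
      intervalIntegral.integral_eq_sub_of_hasDerivAt
        (f := fun v => Real.exp (-ρ * v + -s * (y - v))), expKernel_of_pos _ hy,
        expKernel_of_pos _ hy]
    · simp
    · intro v _
      have : HasDerivAt (fun v : ℝ => -ρ * v + -s * (y - v)) (s - ρ) v := by
        convert! ((hasDerivAt_id v).const_mul (-ρ)).add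
          (((hasDerivAt_id v).const_sub y).const_mul (-s)) using 1
        ring
      simpa [mul_comm] using this.exp
    · exact (by fun_prop : Continuous fun v : ℝ =>
        (s - ρ) * Real.exp (-ρ * v + -s * (y - v))).intervalIntegrable _ _
  · have h1 : ∀ v, expKernel ρ v * expKernel s (y - v) = 0 := by
      intro v
      by_cases h0 : 0 < v
      · rw [expKernel_of_nonpos s (by linarith), mul_zero]
      · rw [expKernel_of_nonpos ρ (by linarith), zero_mul]
    simp [h1, expKernel_of_nonpos _ (not_lt.1 hy)]

/-- The resolvent equation for the translation operators. -/
theorem translationOp_resolvent {s ρ C : ℝ} (hs : 0 < s) (hρ : 0 < ρ) {g : ℝ → ℝ}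
    (hg : Measurable g) (hgC : ∀ x, ‖g x‖ ≤ C) (u : ℝ) :
    translationOp s g u =
      translationOp ρ g u - (s - ρ) * translationOp ρ (translationOp s g) u := by
  have hg' : Measurable fun y => g (u + y) := by fun_prop
  have hint : Integrable (fun p : ℝ × ℝ => expKernel ρ p.1 * expKernel s (p.2 - p.1) * g (u + p.2))
      (volume.prod volume) :=
    (Integrable.mul_comp_sub (integrable_expKernel hρ) (integrable_expKernel hs)).mul_bdd
      (hg'.comp measurable_snd).aestronglyMeasurable (Filter.Eventually.of_forall fun p => hgC _)
  have hE : ∀ a, 0 < a → Integrable fun y => expKernel a y * g (u + y) := fun a ha =>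
    (integrable_expKernel ha).mul_bdd hg'.aestronglyMeasurable
      (Filter.Eventually.of_forall fun p => hgC _)
  -- After a shift of the inner variable and Fubini, T_ρ T_s is the operator whose kernel is the
  -- convolution of the two exponential kernels.
  have h1 : translationOp ρ (translationOp s g) u =
      ∫ y, (∫ v, expKernel ρ v * expKernel s (y - v)) * g (u + y) := by
    calc translationOp ρ (translationOp s g) u
        = ∫ v, ∫ y, expKernel ρ v * expKernel s (y - v) * g (u + y) := by
          rw [translationOp_eq]
          congr 1 with v
          rw [translationOp_eq, ← integral_sub_right_eq_self _ v, ← integral_const_mul]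
          congr 1 with y
          rw [mul_assoc]
          congr 3
          ring
      _ = ∫ y, ∫ v, expKernel ρ v * expKernel s (y - v) * g (u + y) :=
          integral_integral_swap hint
      _ = _ := by simp_rw [integral_mul_const]
  rw [h1, ← integral_const_mul]
  simp_rw [← mul_assoc, integral_expKernel_mul_expKernel, sub_mul]
  rw [integral_sub (hE ρ hρ) (hE s hs), translationOp_eq, translationOp_eq]
  ring

/-! ### Translates of a claim density -/

section Density

variable {f : ℝ → ℝ} {ρ : ℝ}

theorem integrable_expKernel_mul_comp_add (hρ : 0 < ρ) (hf : Integrable f) :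
    Integrable (fun p : ℝ × ℝ => expKernel ρ p.1 * f (p.1 + p.2)) (volume.prod volume) :=
  Integrable.mul_comp_add (integrable_expKernel hρ) hf

theorem integrable_translationOp (hρ : 0 < ρ) (hf : Integrable f) :
    Integrable (translationOp ρ f) := by
  refine (integrable_expKernel_mul_comp_add hρ hf).integral_prod_right.congr ?_
  filter_upwards with w
  simp_rw [translationOp_eq, add_comm w]

theorem measurable_translationOp (hf : Measurable f) : Measurable (translationOp ρ f) := by
  have h : Measurable (Function.uncurry fun x v : ℝ => expKernel ρ v * f (x + v)) :=
    ((measurable_expKernel ρ).comp measurable_snd).mul (by fun_prop)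
  have := (h.stronglyMeasurable.integral_prod_right (ν := volume)).measurable
  simpa only [← translationOp_eq] using this

theorem translationOp_nonneg (hf0 : ∀ x, 0 ≤ f x) (x : ℝ) : 0 ≤ translationOp ρ f x := by
  rw [translationOp_eq]
  exact integral_nonneg fun v => mul_nonneg (expKernel_nonneg _ _) (hf0 _)

theorem translationOp_le_one (hρ : 0 < ρ) (hf0 : ∀ x, 0 ≤ f x) (hf : Integrable f)
    (hf1 : ∫ x, f x = 1) (x : ℝ) : translationOp ρ f x ≤ 1 := by
  rw [translationOp_eq, ← hf1, ← integral_add_left_eq_self f x]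
  refine integral_mono_of_nonneg
    (Filter.Eventually.of_forall fun v => mul_nonneg (expKernel_nonneg _ _) (hf0 _))
    (hf.comp_add_left x) (Filter.Eventually.of_forall fun v => ?_)
  exact mul_le_of_le_one_left (hf0 _) (expKernel_le_one hρ.le v)

/-- The density charges only the positive half-line, so moving the base point left of 0 merely
multiplies by an exponential. This is the source of the term f̂(ρ) T_ρ φ. -/
theorem translationOp_of_nonpos (hf_neg : ∀ x < 0, f x = 0) {w : ℝ} (hw : w ≤ 0) :
    translationOp ρ f w = Real.exp (ρ * w) * laplaceTransform f ρ := by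
  rw [translationOp, laplaceTransform, ← integral_const_mul]
  rw [← integral_indicator measurableSet_Ioi, ← integral_indicator measurableSet_Ioi]
  refine integral_congr_ae ?_
  have hne : ∀ᵐ z : ℝ, z ≠ 0 := by simp [ae_iff]
  filter_upwards [hne] with y hy
  rcases lt_or_gt_of_ne hy with h | h
  · simp [indicator, hf_neg y h]
  · rw [indicator_of_mem (mem_Ioi.2 (by linarith)), indicator_of_mem (mem_Ioi.2 h), ← mul_assoc,
      ← Real.exp_add]
    congr 2
    ring

/-- `T_ρ` of a convolution with a density on the half-line. -/
theorem translationOp_integral_mul (hρ : 0 < ρ) (hf : Integrable f) (hf_neg : ∀ x < 0, f x = 0)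
    {φ : ℝ → ℝ} {C : ℝ} (hφ : Measurable φ) (hφC : ∀ x, ‖φ x‖ ≤ C) (u : ℝ) :
    translationOp ρ (fun y => ∫ x, f x * φ (y - x)) u =
      (∫ w in Ioi 0, φ (u - w) * translationOp ρ f w) +
        laplaceTransform f ρ * translationOp ρ φ u := by
  have hφ' : Measurable fun w => φ (u - w) := by fun_prop
  have hint : Integrable (fun p : ℝ × ℝ => φ (u - p.2) * (expKernel ρ p.1 * f (p.1 + p.2)))
      (volume.prod volume) :=
    (integrable_expKernel_mul_comp_add hρ hf).bdd_mul
      (hφ'.comp measurable_snd).aestronglyMeasurable (Filter.Eventually.of_forall fun p => hφC _)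
  have h1 : translationOp ρ (fun y => ∫ x, f x * φ (y - x)) u =
      ∫ w, φ (u - w) * translationOp ρ f w := by
    calc translationOp ρ (fun y => ∫ x, f x * φ (y - x)) u
        = ∫ v, ∫ w, φ (u - w) * (expKernel ρ v * f (v + w)) := by
          rw [translationOp_eq]
          congr 1 with v
          rw [← integral_add_left_eq_self _ v, ← integral_const_mul]
          congr 1 with w
          rw [show u + v - (v + w) = u - w by ring]
          ring
      _ = ∫ w, ∫ v, φ (u - w) * (expKernel ρ v * f (v + w)) := integral_integral_swap hint
      _ = _ := by simp_rw [integral_const_mul, translationOp_eq, add_comm]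
  have hint2 : Integrable fun w => φ (u - w) * translationOp ρ f w :=
    (integrable_translationOp hρ hf).bdd_mul hφ'.aestronglyMeasurable
      (Filter.Eventually.of_forall fun p => hφC _)
  -- The part w > 0 is the asserted integral; on w ≤ 0 the substitution w = -v turns the explicit
  -- exponential into the kernel of T_ρ φ.
  rw [h1, ← integral_add_compl measurableSet_Ioi hint2, compl_Ioi]
  congr 1
  rw [translationOp_eq, ← integral_const_mul, ← integral_indicator measurableSet_Iic,
    ← integral_neg_eq_self]
  refine integral_congr_ae ?_
  have hne : ∀ᵐ z : ℝ, z ≠ 0 := by simp [ae_iff]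
  filter_upwards [hne] with v hv
  rcases lt_or_gt_of_ne hv with h | h
  · rw [indicator_of_notMem (by simpa using h), expKernel_of_nonpos ρ h.le]
    ring
  · rw [indicator_of_mem (by simpa using h.le), expKernel_of_pos ρ h,
      translationOp_of_nonpos hf_neg (by linarith), sub_neg_eq_add,
      show ρ * -v = -ρ * v by ring]
    ring

/-- The case φ = 1, u = 0 of `translationOp_integral_mul`. -/
theorem integral_Ioi_translationOp (hρ : 0 < ρ) (hf : Integrable f) (hf_neg : ∀ x < 0, f x = 0)
    (hf1 : ∫ x, f x = 1) :
    ∫ w in Ioi 0, translationOp ρ f w = (1 - laplaceTransform f ρ) / ρ := by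
  have h := translationOp_integral_mul (φ := fun _ => 1) hρ hf hf_neg measurable_const
    (C := 1) (by simp) 0
  simp only [mul_one, one_mul, hf1, translationOp_eq ρ (fun _ => 1), integral_expKernel hρ] at h
  rw [sub_div]
  linarith [mul_one_div (laplaceTransform f ρ) ρ]

theorem integral_Ioi_eq_tailOfDensity (hf : Integrable f) (hf1 : ∫ x, f x = 1) (y : ℝ) :
    ∫ x in Ioi y, f x = tailOfDensity f y := by
  have := integral_add_compl (measurableSet_Iic (a := y)) hf
  rw [compl_Iic, hf1] at this
  rw [tailOfDensity]
  linarith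

/-- Fubini: integrating f(v + w) over w > u first produces the tail at u + v. -/
theorem integral_Ioi_translationOp_eq (hρ : 0 < ρ) (hf : Integrable f) (hf1 : ∫ x, f x = 1)
    (u : ℝ) :
    ∫ w in Ioi u, translationOp ρ f w = translationOp ρ (tailOfDensity f) u := by
  have hint : Integrable (fun p : ℝ × ℝ => expKernel ρ p.1 * f (p.1 + p.2))
      (volume.prod (volume.restrict (Ioi u))) := by
    have := (integrable_expKernel_mul_comp_add hρ hf).mono_measure
      (Measure.restrict_le_self (s := univ ×ˢ Ioi u))
    rwa [← Measure.prod_restrict, Measure.restrict_univ] at this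
  calc ∫ w in Ioi u, translationOp ρ f w
      = ∫ w in Ioi u, ∫ v, expKernel ρ v * f (v + w) := by
        simp_rw [translationOp_eq, add_comm]
    _ = ∫ v, ∫ w in Ioi u, expKernel ρ v * f (v + w) := (integral_integral_swap hint).symm
    _ = translationOp ρ (tailOfDensity f) u := by
        rw [translationOp_eq]
        congr 1 with v
        rw [integral_const_mul, ← integral_Ioi_eq_tailOfDensity hf hf1,
          ← integral_indicator measurableSet_Ioi, ← integral_indicator measurableSet_Ioi,
          ← integral_add_left_eq_self ((Ioi (u + v)).indicator f) v]
        congr 2 with w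
        simp [indicator, add_comm u v]

/-! ### The Lundberg equation -/

theorem integrableOn_exp_mul (hf : Integrable f) {s : ℝ} (hs : 0 ≤ s) :
    IntegrableOn (fun x => Real.exp (-s * x) * f x) (Ioi 0) := by
  refine hf.integrableOn.bdd_mul (c := 1) (by fun_prop) ?_
  filter_upwards [ae_restrict_mem measurableSet_Ioi] with x hx
  rw [Real.norm_of_nonneg (Real.exp_pos _).le, Real.exp_le_one_iff]
  nlinarith [mem_Ioi.1 hx]

theorem laplaceTransform_nonneg (hf0 : ∀ x, 0 ≤ f x) (s : ℝ) : 0 ≤ laplaceTransform f s :=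
  integral_nonneg fun _ => mul_nonneg (Real.exp_pos _).le (hf0 _)

theorem laplaceTransform_zero_le (hf0 : ∀ x, 0 ≤ f x) (hf : Integrable f) (hf1 : ∫ x, f x = 1) :
    laplaceTransform f 0 ≤ 1 := by
  simp only [laplaceTransform, neg_zero, zero_mul, Real.exp_zero, one_mul]
  rw [← hf1]
  exact setIntegral_le_integral hf (Filter.Eventually.of_forall hf0)

theorem one_le_laplaceTransform_zero (hf : Integrable f) (hf_neg : ∀ x < 0, f x = 0)
    (hf1 : ∫ x, f x = 1) : 1 ≤ laplaceTransform f 0 := by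
  simp only [laplaceTransform, neg_zero, zero_mul, Real.exp_zero, one_mul]
  have h := integral_Ioi_eq_tailOfDensity hf hf1 0
  rw [h, tailOfDensity, integral_Iic_eq_integral_Iio,
    setIntegral_eq_zero_of_forall_eq_zero fun x hx => hf_neg x (mem_Iio.1 hx), sub_zero]

/-- For x > 0, e^{-sx} - e^{-tx} = e^{-sx}(1 - e^{-(t-s)x}) lies between 0 and (t-s)x. This one
estimate yields continuity of the transform, monotonicity of the Lundberg function, and
defectiveness. -/
theorem laplaceTransform_sub_mem_Icc (hf0 : ∀ x, 0 ≤ f x) (hf : Integrable f)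
    (hf_neg : ∀ x < 0, f x = 0) (hfx : Integrable fun x => x * f x) {s t : ℝ} (hs : 0 ≤ s)
    (hst : s ≤ t) :
    laplaceTransform f s - laplaceTransform f t ∈ Icc 0 ((t - s) * ∫ x, x * f x) := by
  rw [laplaceTransform, laplaceTransform,
    ← integral_sub (integrableOn_exp_mul hf hs) (integrableOn_exp_mul hf (hs.trans hst))]
  constructor
  · refine setIntegral_nonneg measurableSet_Ioi fun x hx => ?_
    rw [← sub_mul]
    refine mul_nonneg (sub_nonneg.2 (Real.exp_le_exp.2 ?_)) (hf0 x)
    nlinarith [mem_Ioi.1 hx]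
  · have hx0 : ∀ x, 0 ≤ x * f x := fun x => by
      rcases lt_or_ge x 0 with h | h
      · simp [hf_neg x h]
      · exact mul_nonneg h (hf0 x)
    calc ∫ x in Ioi 0, Real.exp (-s * x) * f x - Real.exp (-t * x) * f x
        ≤ ∫ x in Ioi 0, (t - s) * (x * f x) := by
          refine setIntegral_mono_on ((integrableOn_exp_mul hf hs).sub
            (integrableOn_exp_mul hf (hs.trans hst))) (hfx.integrableOn.const_mul _)
            measurableSet_Ioi fun x hx => ?_
          rw [← sub_mul, ← mul_assoc]
          refine mul_le_mul_of_nonneg_right ?_ (hf0 x)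
          have hx' := mem_Ioi.1 hx
          have h1 : Real.exp (-t * x) = Real.exp (-s * x) * Real.exp (-((t - s) * x)) := by
            rw [← Real.exp_add]; congr 1; ring
          have h2 : Real.exp (-s * x) ≤ 1 := by rw [Real.exp_le_one_iff]; nlinarith
          have h3 := Real.add_one_le_exp (-((t - s) * x))
          have h4 : 0 ≤ (t - s) * x := mul_nonneg (by linarith) hx'.le
          rw [h1]
          nlinarith [Real.exp_pos (-s * x), mul_nonneg (Real.exp_pos (-s * x)).le (sub_nonneg.2 h3)]
      _ ≤ ∫ x, (t - s) * (x * f x) :=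
          setIntegral_le_integral (hfx.const_mul _) (Filter.Eventually.of_forall fun x =>
            mul_nonneg (by linarith) (hx0 x))
      _ = _ := integral_const_mul _ _

/-- The term cs grows faster than λr f̂ can fall, since λr EX < c; so the Lundberg function is
strictly increasing on [0, ∞). It is at most λ(r-1) - δ < 0 at 0, and nonnegative at (λ+δ)/c because
f̂ ≥ 0. -/
theorem existsUnique_isPositiveLundbergRoot {c lam δ r : ℝ} (hlam : 0 < lam) (hδ : 0 < δ)
    (hr : 0 < r) (hr1 : r ≤ 1) (hf0 : ∀ x, 0 ≤ f x) (hf : Integrable f)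
    (hf_neg : ∀ x < 0, f x = 0) (hf1 : ∫ x, f x = 1) (hfx : Integrable fun x => x * f x)
    (hc : 0 < c) (hnet : lam * r * ∫ x, x * f x < c) :
    ∃! ρ : ℝ, IsPositiveLundbergRoot c lam δ r f ρ := by
  set ell : ℝ → ℝ := fun s => c * s - (lam + δ) + lam * r * laplaceTransform f s with hell
  have hlr : 0 < lam * r := mul_pos hlam hr
  have hstrict : ∀ s t, 0 ≤ s → s < t → ell s < ell t := by
    intro s t hs hst
    have h := (laplaceTransform_sub_mem_Icc hf0 hf hf_neg hfx hs hst.le).2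
    have h1 := mul_le_mul_of_nonneg_left h hlr.le
    have h2 := mul_lt_mul_of_pos_left hnet (sub_pos.2 hst)
    simp only [hell]
    nlinarith
  have hcont : ContinuousOn (laplaceTransform f) (Ici 0) := by
    have hLip : LipschitzOnWith (Real.toNNReal (∫ x, x * f x)) (laplaceTransform f) (Ici 0) := by
      refine LipschitzOnWith.of_le_add_mul _ fun s hs t ht => ?_
      have hm : (∫ x, x * f x) ≤ Real.toNNReal (∫ x, x * f x) := Real.le_coe_toNNReal _
      rcases le_total s t with h | h
      · have h1 := (laplaceTransform_sub_mem_Icc hf0 hf hf_neg hfx hs h).2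
        rw [Real.dist_eq, abs_sub_comm, abs_of_nonneg (sub_nonneg.2 h)]
        nlinarith [mul_le_mul_of_nonneg_left hm (sub_nonneg.2 h)]
      · have h1 := (laplaceTransform_sub_mem_Icc hf0 hf hf_neg hfx ht h).1
        have : 0 ≤ (Real.toNNReal (∫ x, x * f x) : ℝ) * dist s t := by positivity
        linarith
    exact hLip.continuousOn
  have h0 : ell 0 < 0 := by
    have := mul_le_mul_of_nonneg_left (laplaceTransform_zero_le hf0 hf hf1) hlr.le
    simp only [hell]
    nlinarith
  have hM : 0 ≤ ell ((lam + δ) / c) := by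
    have := mul_nonneg hlr.le (laplaceTransform_nonneg hf0 ((lam + δ) / c))
    simp only [hell]
    rw [mul_div_cancel₀ _ hc.ne']
    linarith
  have hM0 : 0 ≤ (lam + δ) / c := by positivity
  have hcont' : ContinuousOn ell (Icc 0 ((lam + δ) / c)) :=
    ((by fun_prop : Continuous fun s : ℝ => c * s - (lam + δ)).continuousOn).add
      (continuousOn_const.mul (hcont.mono Icc_subset_Ici_self))
  obtain ⟨ρ, hρ, hρ0⟩ := intermediate_value_Icc hM0 hcont' ⟨h0.le, hM⟩
  have hρpos : 0 < ρ := lt_of_le_of_ne hρ.1 fun h => by rw [← h] at hρ0; linarith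
  refine ⟨ρ, ⟨hρpos, hρ0⟩, fun ρ' hρ' => ?_⟩
  have hρ'0 : ell ρ' = 0 := hρ'.2
  rcases lt_trichotomy ρ' ρ with h | h | h
  · have := hstrict _ _ hρ'.1.le h
    linarith
  · exact h
  · have := hstrict _ _ hρpos.le h
    linarith

/-- The integral equals (1 - f̂(ρ))/ρ, a difference quotient of the Laplace transform between 0 and
ρ, hence at most EX. -/
theorem mul_integral_translationOp_lt_one {k : ℝ} (hρ : 0 < ρ) (hf0 : ∀ x, 0 ≤ f x)
    (hf : Integrable f) (hf_neg : ∀ x < 0, f x = 0) (hf1 : ∫ x, f x = 1)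
    (hfx : Integrable fun x => x * f x) (hk : 0 ≤ k) (hnet : k * ∫ x, x * f x < 1) :
    k * ∫ x in Ioi 0, translationOp ρ f x < 1 := by
  rw [integral_Ioi_translationOp hρ hf hf_neg hf1]
  have h := (laplaceTransform_sub_mem_Icc hf0 hf hf_neg hfx le_rfl hρ.le).2
  have h1 := one_le_laplaceTransform_zero hf hf_neg hf1
  have h2 : (1 - laplaceTransform f ρ) / ρ ≤ ∫ x, x * f x := by
    rw [div_le_iff₀ hρ]
    linarith
  exact (mul_le_mul_of_nonneg_left h2 hk).trans_lt hnet

/-! ### The renewal equation -/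

/-- The step that replaces the exponent s by the Lundberg root: `hroot` is exactly the condition
under which the double translates T_ρ T_s g cancel. -/
theorem eq_mul_integral_translationOp {φ : ℝ → ℝ} {k s u C : ℝ} (hs : 0 < s) (hρ : 0 < ρ)
    (hf_meas : Measurable f) (hf : Integrable f) (hf_neg : ∀ x < 0, f x = 0)
    (hφ : Measurable φ) (hφC : ∀ x, ‖φ x‖ ≤ C) (hroot : s - ρ = k * laplaceTransform f ρ)
    (hrec : ∀ v, u ≤ v → φ v = k * translationOp s (fun y => ∫ x, f x * φ (y - x)) v) :
    φ u = k * ∫ w in Ioi 0, φ (u - w) * translationOp ρ f w := by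
  set g : ℝ → ℝ := fun y => ∫ x, f x * φ (y - x) with hg
  have hgm : Measurable g := by
    have h : Measurable fun p : ℝ × ℝ => f p.2 * φ (p.1 - p.2) := by fun_prop
    exact h.stronglyMeasurable.integral_prod_right.measurable
  have hgC : ∀ y, ‖g y‖ ≤ ∫ x, ‖f x‖ * C := fun y => by
    refine norm_integral_le_of_norm_le (hf.norm.mul_const C)
      (Filter.Eventually.of_forall fun x => ?_)
    rw [norm_mul]
    exact mul_le_mul_of_nonneg_left (hφC _) (norm_nonneg _)
  have h1 := translationOp_resolvent hs hρ hgm hgC u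
  have h2 := translationOp_integral_mul hρ hf hf_neg hφ hφC u
  -- The value T_ρ φ(u) involves φ only above u, where `hrec` applies.
  have h3 : translationOp ρ φ u = k * translationOp ρ (translationOp s g) u := by
    rw [translationOp, translationOp, ← integral_const_mul]
    refine setIntegral_congr_fun measurableSet_Ioi fun y hy => ?_
    rw [hrec y (mem_Ioi.1 hy).le]
    ring
  rw [hrec u le_rfl, h1]
  rw [← hg] at h2
  rw [h2, hroot, h3]
  ring

end Density

/-! ### Convolution on the half-line and the Neumann series of the renewal equation -/

theorem measurable_halfLineConv {g k : ℝ → ℝ} (hg : Measurable g) (hk : Measurable k) :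
    Measurable (halfLineConv g k) := by
  have h : ∀ S : Set (ℝ × ℝ), MeasurableSet S → Measurable fun t : ℝ =>
      ∫ x, S.indicator (fun p : ℝ × ℝ => g p.2 * k (p.1 - p.2)) (t, x) := fun S hS => by
    have : Measurable (Function.uncurry fun t x : ℝ =>
        S.indicator (fun p : ℝ × ℝ => g p.2 * k (p.1 - p.2)) (t, x)) :=
      Measurable.indicator (by fun_prop) hS
    exact (this.stronglyMeasurable.integral_prod_right (ν := volume)).measurable
  -- The two planar regions give the integrals over (0, t] and (t, 0], whose difference is the
  -- interval integral for either sign of t.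
  have h1 := h ({p | 0 < p.2} ∩ {p | p.2 ≤ p.1})
    ((measurableSet_lt (by fun_prop) (by fun_prop)).inter (measurableSet_le (by fun_prop) (by fun_prop)))
  have h2 := h ({p | p.1 < p.2} ∩ {p | p.2 ≤ 0})
    ((measurableSet_lt (by fun_prop) (by fun_prop)).inter (measurableSet_le (by fun_prop) (by fun_prop)))
  convert! h1.sub h2 using 1
  funext t
  rw [halfLineConv, intervalIntegral, ← integral_indicator measurableSet_Ioc,
    ← integral_indicator measurableSet_Ioc]
  rfl

theorem intervalIntegrable_of_bounded {g : ℝ → ℝ} {y C : ℝ} (hg : Measurable g) (hy : 0 ≤ y)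
    (hC : ∀ x ∈ Icc 0 y, ‖g x‖ ≤ C) : IntervalIntegrable g volume 0 y := by
  rw [intervalIntegrable_iff_integrableOn_Ioc_of_le hy]
  refine IntegrableOn.of_bound measure_Ioc_lt_top hg.aestronglyMeasurable C ?_
  filter_upwards [ae_restrict_mem measurableSet_Ioc] with x hx
  exact hC x (Ioc_subset_Icc_self hx)

/-- Both sides integrate A(t) B(x-t) C(y-x) over the triangle 0 < t < x ≤ y. The bound on A is only
local because self-convolutions are controlled by powers of x. -/
theorem halfLineConv_assoc {A B C : ℝ → ℝ} {y M : ℝ} (hA : Measurable A) (hB : Measurable B)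
    (hC : Measurable C) (hy : 0 ≤ y) (hAM : ∀ x ∈ Icc 0 y, ‖A x‖ ≤ M) (hB1 : ∀ x, ‖B x‖ ≤ 1)
    (hC1 : ∀ x, ‖C x‖ ≤ 1) :
    halfLineConv (halfLineConv A B) C y = halfLineConv A (halfLineConv B C) y := by
  set K : ℝ → ℝ → ℝ := fun t x => if t < x then A t * B (x - t) * C (y - x) else 0 with hK
  have hKm : Measurable (Function.uncurry K) :=
    Measurable.ite (measurableSet_lt measurable_fst measurable_snd) (by fun_prop) measurable_const
  have hint : Integrable (Function.uncurry K)
      ((volume.restrict (Ioc 0 y)).prod (volume.restrict (Ioc 0 y))) := by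
    have hM : 0 ≤ M := (norm_nonneg _).trans (hAM 0 ⟨le_rfl, hy⟩)
    refine Integrable.of_bound hKm.aestronglyMeasurable M ?_
    have h1 : ∀ᵐ p ∂((volume.restrict (Ioc 0 y)).prod (volume.restrict (Ioc 0 y))),
        p.1 ∈ Ioc 0 y :=
      Measure.quasiMeasurePreserving_fst.ae (ae_restrict_mem measurableSet_Ioc)
    filter_upwards [h1] with p hp
    simp only [Function.uncurry, hK]
    split_ifs
    · rw [norm_mul, norm_mul]
      have h2 := hAM p.1 (Ioc_subset_Icc_self hp)
      calc _ ≤ M * 1 * 1 := by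
            gcongr
            exacts [hB1 _, hC1 _]
        _ = M := by ring
    · simpa using hM
  have hleft : halfLineConv (halfLineConv A B) C y =
      ∫ x in Ioc 0 y, ∫ t in Ioc 0 y, K t x := by
    rw [halfLineConv, intervalIntegral.integral_of_le hy]
    refine setIntegral_congr_fun measurableSet_Ioc fun x hx => ?_
    rw [halfLineConv, intervalIntegral.integral_of_le hx.1.le, integral_Ioc_eq_integral_Ioo,
      ← integral_mul_const, ← integral_indicator measurableSet_Ioo,
      ← integral_indicator measurableSet_Ioc]
    congr 1 with t
    simp only [indicator, hK, mem_Ioo, mem_Ioc]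
    have := hx.2
    by_cases h0 : 0 < t <;> by_cases h1 : t < x <;> simp [h0, h1]
    intro h2
    linarith
  have hright : halfLineConv A (halfLineConv B C) y =
      ∫ t in Ioc 0 y, ∫ x in Ioc 0 y, K t x := by
    rw [halfLineConv, intervalIntegral.integral_of_le hy]
    refine setIntegral_congr_fun measurableSet_Ioc fun t ht => ?_
    have h1 : halfLineConv B C (y - t) = ∫ x in t..y, B (x - t) * C (y - x) := by
      have := intervalIntegral.integral_comp_sub_right (a := t) (b := y)
        (fun z => B z * C (y - t - z)) t
      rw [sub_self] at this
      rw [halfLineConv, ← this]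
      congr 1 with x
      congr 2
      ring
    rw [h1, intervalIntegral.integral_of_le ht.2, ← integral_const_mul,
      ← integral_indicator measurableSet_Ioc, ← integral_indicator measurableSet_Ioc]
    congr 1 with x
    simp only [indicator, hK, mem_Ioc]
    have := ht.1
    by_cases h0 : t < x <;> by_cases h1 : x ≤ y <;> simp [h0, h1]
    · rw [if_pos (by linarith)]
      ring
  rw [hleft, hright]
  exact integral_integral_swap (f := fun x t => K t x) hint.swap

theorem measurable_selfConv {G : ℝ → ℝ} (hG : Measurable G) (n : ℕ) :
    Measurable (selfConv G n) := by
  induction n with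
  | zero => exact hG
  | succ n ih => exact measurable_halfLineConv ih hG

theorem halfLineConv_nonneg {g k : ℝ → ℝ} (hg : ∀ x, 0 ≤ x → 0 ≤ g x) (hk : ∀ x, 0 ≤ x → 0 ≤ k x)
    {y : ℝ} (hy : 0 ≤ y) : 0 ≤ halfLineConv g k y :=
  intervalIntegral.integral_nonneg hy fun x hx =>
    mul_nonneg (hg x hx.1) (hk _ (sub_nonneg.2 hx.2))

/-- Convolution with a function bounded by `1` increases the power in a bound `x^n / n!`. -/
theorem halfLineConv_le {g k : ℝ → ℝ} {n : ℕ} (hg : Measurable g) (hk : Measurable k)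
    (hg0 : ∀ x, 0 ≤ x → 0 ≤ g x) (hgn : ∀ x, 0 ≤ x → g x ≤ x ^ n / n.factorial)
    (hk01 : ∀ x, k x ∈ Icc (0 : ℝ) 1) {y : ℝ} (hy : 0 ≤ y) :
    halfLineConv g k y ≤ y ^ (n + 1) / (n + 1).factorial := by
  calc halfLineConv g k y ≤ ∫ x in (0 : ℝ)..y, x ^ n / n.factorial := by
        refine intervalIntegral.integral_mono_on hy (intervalIntegrable_of_bounded
          (C := y ^ n / n.factorial) (by fun_prop) hy fun x hx => ?_)
          ((by fun_prop : Continuous fun x : ℝ => x ^ n / (n.factorial : ℝ)).intervalIntegrable _ _)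
          fun x hx => ?_
        · rw [Real.norm_of_nonneg (mul_nonneg (hg0 x hx.1) (hk01 _).1)]
          refine (mul_le_of_le_one_right (hg0 x hx.1) (hk01 _).2).trans ((hgn x hx.1).trans ?_)
          have := hx.1
          have := hx.2
          gcongr
        · exact (mul_le_of_le_one_right (hg0 x hx.1) (hk01 _).2).trans (hgn x hx.1)
    _ = y ^ (n + 1) / (n + 1).factorial := by
        rw [intervalIntegral.integral_div, integral_pow, Nat.factorial_succ]
        push_cast
        field_simp
        simp

theorem selfConv_mem_Icc {G : ℝ → ℝ} (hG : Measurable G) (hG01 : ∀ x, G x ∈ Icc (0 : ℝ) 1) (n : ℕ)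
    (x : ℝ) (hx : 0 ≤ x) : selfConv G n x ∈ Icc 0 (x ^ n / n.factorial) := by
  induction n generalizing x with
  | zero => simpa [selfConv] using hG01 x
  | succ n ih =>
    exact ⟨halfLineConv_nonneg (fun x hx => (ih x hx).1) (fun x _ => (hG01 x).1) hx,
      halfLineConv_le (measurable_selfConv hG n) hG (fun x hx => (ih x hx).1)
        (fun x hx => (ih x hx).2) hG01 hx⟩

section Renewal

variable {G h ψ : ℝ → ℝ} {k : ℝ}

theorem convPowConv_mem_Icc (hG : Measurable G) (hG01 : ∀ x, G x ∈ Icc (0 : ℝ) 1)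
    (hψ : Measurable ψ) (hψ01 : ∀ x, ψ x ∈ Icc (0 : ℝ) 1) (n : ℕ) {y : ℝ} (hy : 0 ≤ y) :
    convPowConv G ψ n y ∈ Icc 0 (y ^ n / n.factorial) := by
  cases n with
  | zero => simpa [convPowConv] using hψ01 y
  | succ n =>
    have ih := selfConv_mem_Icc hG hG01 n
    exact ⟨halfLineConv_nonneg (fun x hx => (ih x hx).1) (fun x _ => (hψ01 x).1) hy,
      halfLineConv_le (measurable_selfConv hG n) hψ (fun x hx => (ih x hx).1)
        (fun x hx => (ih x hx).2) hψ01 hy⟩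

theorem convPowConv_nonneg (hG : Measurable G) (hG01 : ∀ x, G x ∈ Icc (0 : ℝ) 1)
    (hh : ∀ x, 0 ≤ x → 0 ≤ h x) (n : ℕ) {y : ℝ} (hy : 0 ≤ y) : 0 ≤ convPowConv G h n y := by
  cases n with
  | zero => exact hh y hy
  | succ n => exact halfLineConv_nonneg (fun x hx => (selfConv_mem_Icc hG hG01 n x hx).1) hh hy

/-- The renewal equation convolved with the n-fold convolution of G: one step of the iteration. -/
theorem convPowConv_eq_of_renewal (hG : Measurable G) (hG01 : ∀ x, G x ∈ Icc (0 : ℝ) 1)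
    (hψ : Measurable ψ) (hψ01 : ∀ x, ψ x ∈ Icc (0 : ℝ) 1) (hk : 0 < k)
    (hren : ∀ y, 0 < y → ψ y = k * (halfLineConv G ψ y + h y)) (n : ℕ) {y : ℝ} (hy : 0 < y) :
    convPowConv G ψ n y = k * convPowConv G h n y + k * convPowConv G ψ (n + 1) y := by
  cases n with
  | zero =>
    simp only [convPowConv, selfConv]
    rw [hren y hy]
    ring
  | succ n =>
    have hS := measurable_selfConv hG n
    have hSI := selfConv_mem_Icc hG hG01 n
    have hGψ := measurable_halfLineConv hG hψ
    have hnorm : ∀ {a : ℝ}, a ∈ Icc (0 : ℝ) 1 → ‖a‖ ≤ 1 := fun ha => by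
      rw [Real.norm_of_nonneg ha.1]; exact ha.2
    have hSM : ∀ x ∈ Icc 0 y, ‖selfConv G n x‖ ≤ y ^ n / n.factorial := fun x hx => by
      rw [Real.norm_of_nonneg (hSI x hx.1).1]
      refine (hSI x hx.1).2.trans ?_
      have := hx.1
      have := hx.2
      gcongr
    have hassoc : halfLineConv (selfConv G (n + 1)) ψ y =
        ∫ x in (0 : ℝ)..y, selfConv G n x * halfLineConv G ψ (y - x) :=
      halfLineConv_assoc hS hG hψ hy.le hSM (fun x => hnorm (hG01 x)) (fun x => hnorm (hψ01 x))
    have hi1 : IntervalIntegrable (fun x => selfConv G n x * halfLineConv G ψ (y - x))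
        volume 0 y := by
      refine intervalIntegrable_of_bounded (C := y ^ n / n.factorial * y)
        (hS.mul (hGψ.comp (measurable_const.sub measurable_id))) hy.le fun x hx => ?_
      rw [norm_mul]
      refine mul_le_mul (hSM x hx) ?_ (norm_nonneg _) (by positivity)
      have hyx : 0 ≤ y - x := sub_nonneg.2 hx.2
      have h1 := convPowConv_mem_Icc hG hG01 hψ hψ01 1 hyx
      simp only [convPowConv, selfConv, pow_one, Nat.factorial_one, Nat.cast_one, div_one] at h1
      rw [Real.norm_of_nonneg h1.1]
      linarith [h1.2, hx.1]
    have hi2 : IntervalIntegrable (fun x => selfConv G n x * ψ (y - x)) volume 0 y := by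
      refine intervalIntegrable_of_bounded (C := y ^ n / n.factorial * 1)
        (hS.mul (hψ.comp (measurable_const.sub measurable_id))) hy.le fun x hx => ?_
      rw [norm_mul]
      exact mul_le_mul (hSM x hx) (hnorm (hψ01 _)) (norm_nonneg _) (by positivity)
    -- No regularity of h is assumed: the renewal equation expresses it as k⁻¹ψ - G*ψ. The equation
    -- is known only at positive arguments, so the null point x = y is dropped.
    have hh : convPowConv G h (n + 1) y =
        ∫ x in (0 : ℝ)..y, k⁻¹ * (selfConv G n x * ψ (y - x)) -
          selfConv G n x * halfLineConv G ψ (y - x) := by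
      rw [convPowConv, halfLineConv]
      refine intervalIntegral.integral_congr_ae ?_
      have hne : ∀ᵐ z : ℝ, z ≠ y := by simp [ae_iff]
      filter_upwards [hne] with x hx hx'
      rw [uIoc_of_le hy.le] at hx'
      rw [hren (y - x) (sub_pos.2 (lt_of_le_of_ne hx'.2 hx))]
      field_simp
      ring
    have hlast : convPowConv G ψ (n + 2) y =
        ∫ x in (0 : ℝ)..y, selfConv G n x * halfLineConv G ψ (y - x) := hassoc
    rw [hh, hlast, intervalIntegral.integral_sub (hi2.const_mul _) hi1,
      intervalIntegral.integral_const_mul, mul_sub, ← mul_assoc, mul_inv_cancel₀ hk.ne', one_mul,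
      sub_add_cancel]
    rfl

/-- A bounded solution of a renewal equation is given by its Neumann series. -/
theorem hasSum_of_renewal (hG : Measurable G) (hG01 : ∀ x, G x ∈ Icc (0 : ℝ) 1)
    (hψ : Measurable ψ) (hψ01 : ∀ x, ψ x ∈ Icc (0 : ℝ) 1) (hk : 0 < k)
    (hh : ∀ x, 0 ≤ x → 0 ≤ h x)
    (hren : ∀ y, 0 < y → ψ y = k * (halfLineConv G ψ y + h y)) {y : ℝ} (hy : 0 < y) :
    HasSum (fun n : ℕ => k ^ (n + 1) * convPowConv G h n y) (ψ y) := by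
  rw [hasSum_iff_tendsto_nat_of_nonneg fun n =>
    mul_nonneg (pow_nonneg hk.le _) (convPowConv_nonneg hG hG01 hh n hy.le)]
  have hpartial : ∀ n : ℕ, ∑ i ∈ Finset.range n, k ^ (i + 1) * convPowConv G h i y =
      ψ y - k ^ n * convPowConv G ψ n y := by
    intro n
    induction n with
    | zero => simp [convPowConv]
    | succ n ih =>
      rw [Finset.sum_range_succ, ih, convPowConv_eq_of_renewal hG hG01 hψ hψ01 hk hren n hy]
      ring
  -- The remainder is at most (ky)^n/n!.
  have hrem : Filter.Tendsto (fun n : ℕ => k ^ n * convPowConv G ψ n y) Filter.atTop (nhds 0) := by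
    refine squeeze_zero (fun n => mul_nonneg (pow_nonneg hk.le n)
      (convPowConv_mem_Icc hG hG01 hψ hψ01 n hy.le).1) (fun n => ?_)
      (FloorSemiring.tendsto_pow_div_factorial_atTop (k * y))
    rw [mul_pow, mul_div_assoc]
    exact mul_le_mul_of_nonneg_left (convPowConv_mem_Icc hG hG01 hψ hψ01 n hy.le).2
      (pow_nonneg hk.le n)
  simp_rw [hpartial]
  simpa using hrem.const_sub (ψ y)

end Renewal

/-! ### The renewal equation of the refracted risk process -/

theorem integrable_density_of_map_eq {Ω : Type*} [MeasurableSpace Ω] {P : Measure Ω}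
    [IsProbabilityMeasure P] {X : Ω → ℝ} {f : ℝ → ℝ} (hX : Measurable X) (hf_meas : Measurable f)
    (hf0 : ∀ x, 0 ≤ f x)
    (hlaw : P.map X = volume.withDensity fun x => ENNReal.ofReal (f x)) :
    Integrable f ∧ ∫ x, f x = 1 := by
  have : IsProbabilityMeasure (P.map X) := Measure.isProbabilityMeasure_map hX.aemeasurable
  have h1 : ∫⁻ x, ENNReal.ofReal (f x) = 1 := by
    have := measure_univ (μ := P.map X)
    rwa [hlaw, withDensity_apply _ MeasurableSet.univ, Measure.restrict_univ] at this
  constructor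
  · refine ⟨hf_meas.aestronglyMeasurable, ?_⟩
    rw [hasFiniteIntegral_iff_ofReal (Filter.Eventually.of_forall hf0), h1]
    exact ENNReal.one_lt_top
  · rw [integral_eq_lintegral_of_nonneg_ae (Filter.Eventually.of_forall hf0)
      hf_meas.aestronglyMeasurable, h1, ENNReal.toReal_one]

theorem integrable_mul_density_of_map_eq {Ω : Type*} [MeasurableSpace Ω] {P : Measure Ω}
    {X : Ω → ℝ} {f : ℝ → ℝ} (hX : Measurable X) (hf_meas : Measurable f)
    (hf0 : ∀ x, 0 ≤ f x) (hlaw : P.map X = volume.withDensity fun x => ENNReal.ofReal (f x))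
    (hint : Integrable X P) :
    Integrable (fun x => x * f x) ∧ ∫ ω, X ω ∂P = ∫ x, x * f x := by
  constructor
  · have h : Integrable (fun x : ℝ => x) (P.map X) :=
      (integrable_map_measure measurable_id.aestronglyMeasurable hX.aemeasurable).2 hint
    rw [hlaw, integrable_withDensity_iff hf_meas.ennreal_ofReal (by simp)] at h
    simpa [hf0] using h
  · have h := integral_map (μ := P) hX.aemeasurable (f := fun x : ℝ => x)
      measurable_id.aestronglyMeasurable
    rw [← h, hlaw, integral_withDensity_ofReal hf_meas hf0]
    simp_rw [mul_comm]

/-- Conditioning on the first claim, for an initial surplus above the threshold. -/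
theorem eq_mul_translationOp_of_firstClaim {c₁ c₂ b lam r δ v : ℝ} {f φ : ℝ → ℝ} (hc₂ : 0 < c₂)
    (hlam : 0 < lam) (hf_meas : Measurable f) (hf0 : ∀ x, 0 ≤ f x) (hv : b < v)
    (hfirst : φ v = ∫ t, ∫ x, r * Real.exp (-δ * t) * φ (refractedFlow c₁ c₂ b v t - x)
      ∂(volume.withDensity (fun x => ENNReal.ofReal (f x))) ∂(expMeasure lam)) :
    φ v = lam * r / c₂ *
      translationOp ((lam + δ) / c₂) (fun y => ∫ x, f x * φ (y - x)) v := by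
  -- Starting above b the flow is v + c₂t for all t; the substitution y = c₂t turns the combined
  -- killing e^{-(λ+δ)t} into e^{-sy} with s = (λ+δ)/c₂.
  have hsub := integral_comp_mul_left_Ioi (fun y => Real.exp (-((lam + δ) / c₂) * y) *
    ∫ x, f x * φ (v + y - x)) 0 hc₂
  rw [mul_zero, smul_eq_mul] at hsub
  rw [hfirst, integral_expMeasure hlam, translationOp_eq, integral_expKernel_mul,
    div_mul_eq_mul_div, mul_div_assoc, div_eq_inv_mul _ c₂, ← hsub, ← integral_const_mul]
  refine setIntegral_congr_fun measurableSet_Ioi fun t _ => ?_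
  rw [integral_const_mul, integral_withDensity_ofReal hf_meas hf0]
  simp only [refractedFlow, if_pos hv]
  rw [show -((lam + δ) / c₂) * (c₂ * t) = -lam * t + -δ * t by field_simp; ring, Real.exp_add]
  ring

section Split

variable {φ f : ℝ → ℝ} {b k ρ u : ℝ}

/-- Beyond w = u the argument u - w is negative, where φ = 1, so that part of the integral is ∫_u^∞
T_ρ f = T_ρ F̄(u). -/
theorem renewalEquation_of_eq_integral (hφ : Measurable φ) (hφ01 : ∀ x, φ x ∈ Icc (0 : ℝ) 1)
    (hφneg : ∀ x < 0, φ x = 1) (hρ : 0 < ρ) (hf : Integrable f) (hf1 : ∫ x, f x = 1)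
    (hb : 0 < b) (hu : b < u)
    (h : φ u = k * ∫ w in Ioi 0, φ (u - w) * translationOp ρ f w) :
    φ u = k * ((∫ x in (0 : ℝ)..(u - b), φ (u - x) * translationOp ρ f x) +
      (∫ x in (u - b)..u, φ (u - x) * translationOp ρ f x) +
        translationOp ρ (tailOfDensity f) u) := by
  have hint : Integrable fun w => φ (u - w) * translationOp ρ f w :=
    (integrable_translationOp hρ hf).bdd_mul (c := 1)
      (hφ.comp (measurable_const.sub measurable_id)).aestronglyMeasurable
      (Filter.Eventually.of_forall fun w => by
        rw [Real.norm_of_nonneg (hφ01 _).1]; exact (hφ01 _).2)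
  rw [h, intervalIntegral.integral_add_adjacent_intervals hint.intervalIntegrable
    hint.intervalIntegrable, intervalIntegral.integral_of_le (by linarith),
    ← Ioc_union_Ioi_eq_Ioi (by linarith : (0 : ℝ) ≤ u),
    setIntegral_union (Ioc_disjoint_Ioi le_rfl) measurableSet_Ioi hint.integrableOn
      hint.integrableOn, ← integral_Ioi_translationOp_eq hρ hf hf1]
  congr 2
  refine setIntegral_congr_fun measurableSet_Ioi fun w hw => ?_
  simp only [hφneg _ (sub_neg.2 (mem_Ioi.1 hw)), one_mul]

theorem renewalForcing_nonneg (hφ01 : ∀ x, φ x ∈ Icc (0 : ℝ) 1) (hf0 : ∀ x, 0 ≤ f x)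
    (hρ : 0 < ρ) (hf : Integrable f) (hf1 : ∫ x, f x = 1) (hb : 0 < b) (y : ℝ) :
    0 ≤ renewalForcing φ f b ρ y := by
  refine add_nonneg (intervalIntegral.integral_nonneg (by linarith) fun x _ =>
    mul_nonneg (hφ01 _).1 (translationOp_nonneg hf0 x)) ?_
  rw [← integral_Ioi_translationOp_eq hρ hf hf1]
  exact integral_nonneg fun x => translationOp_nonneg hf0 x

end Split

theorem mainTheorem5 {Ω : Type*} [MeasurableSpace Ω] (P : Measure Ω) [IsProbabilityMeasure P]
    (c₁ c₂ b lam r δ : ℝ) (f : ℝ → ℝ) (W X : ℕ → Ω → ℝ)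
    (hlam : 0 < lam) (hδ : 0 < δ) (hr : 0 < r) (hr1 : r ≤ 1) (hb : 0 < b) (hc : c₂ < c₁)
    -- the claim sizes are nonnegative with density `f`
    (hf_meas : Measurable f) (hf_nonneg : ∀ x, 0 ≤ f x) (hf_neg : ∀ x < 0, f x = 0)
    (hX_meas : ∀ i, Measurable (X i))
    (hX_law : ∀ i, P.map (X i) = volume.withDensity (fun x => ENNReal.ofReal (f x)))
    -- the waiting times between claims are exponentially distributed with parameter `lam`
    (hW_meas : ∀ i, Measurable (W i))
    (hW_law : ∀ i, P.map (W i) = expMeasure lam)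
    -- all waiting times and claim sizes are independent
    (hindep : iIndepFun (Sum.elim W X) P)
    -- net profit condition
    (hX_int : Integrable (X 0) P) (hnet : lam * ∫ ω, X 0 ω ∂P < c₂) :
    (∃! ρ : ℝ, IsPositiveLundbergRoot c₂ lam δ r f ρ) ∧
    ∀ ρ₂ : ℝ, IsPositiveLundbergRoot c₂ lam δ r f ρ₂ →
      -- the series representation
      (∀ u : ℝ, b < u →
        HasSum
          (fun n : ℕ => (lam * r / c₂) ^ (n + 1) *
            convPowConv (translationOp ρ₂ f)
              (renewalForcing (ruinTransform P W X c₁ c₂ b r δ) f b ρ₂) n (u - b))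
          (ruinTransform P W X c₁ c₂ b r δ u)) ∧
      -- the renewal equation
      (∀ u : ℝ, b < u →
        ruinTransform P W X c₁ c₂ b r δ u =
          lam * r / c₂ *
            ((∫ x in (0 : ℝ)..(u - b),
                ruinTransform P W X c₁ c₂ b r δ (u - x) * translationOp ρ₂ f x) +
              (∫ x in (u - b)..u,
                ruinTransform P W X c₁ c₂ b r δ (u - x) * translationOp ρ₂ f x) +
              translationOp ρ₂ (tailOfDensity f) u)) ∧
      -- the renewal equation is defective
      IntegrableOn (translationOp ρ₂ f) (Ioi 0) ∧
      lam * r / c₂ * (∫ x in Ioi (0 : ℝ), translationOp ρ₂ f x) < 1 := by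
  obtain ⟨hf, hf1⟩ := integrable_density_of_map_eq (hX_meas 0) hf_meas hf_nonneg (hX_law 0)
  obtain ⟨hfx, hmean⟩ :=
    integrable_mul_density_of_map_eq (hX_meas 0) hf_meas hf_nonneg (hX_law 0) hX_int
  have hEX : 0 ≤ ∫ x, x * f x := integral_nonneg fun x => by
    rcases lt_or_ge x 0 with h | h
    · simp [hf_neg x h]
    · exact mul_nonneg h (hf_nonneg x)
  rw [hmean] at hnet
  -- Positivity of the premium rates follows from net profit, as EX ≥ 0.
  have hc₂ : 0 < c₂ := (mul_nonneg hlam.le hEX).trans_lt hnet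
  have hc₁ : 0 < c₁ := hc₂.trans hc
  have hnet' : lam * r * ∫ x, x * f x < c₂ := by
    nlinarith [mul_nonneg (mul_nonneg hlam.le hEX) (sub_nonneg.2 hr1)]
  have hk : 0 < lam * r / c₂ := by positivity
  refine ⟨existsUnique_isPositiveLundbergRoot hlam hδ hr hr1 hf_nonneg hf hf_neg hf1 hfx hc₂ hnet',
    ?_⟩
  rintro ρ ⟨hρ, hroot⟩
  obtain ⟨hφ, hφ01, hφneg, hfirst⟩ := ruinTransform_spec hc₁ hc₂ hb hr hr1 hδ hX_meas hX_law
    hW_meas hW_law hindep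
  set φ := ruinTransform P W X c₁ c₂ b r δ
  have hroot' : (lam + δ) / c₂ - ρ = lam * r / c₂ * laplaceTransform f ρ := by
    field_simp
    linarith
  have hrenewal : ∀ u, b < u → φ u = lam * r / c₂ *
      ((∫ x in (0 : ℝ)..(u - b), φ (u - x) * translationOp ρ f x) +
        (∫ x in (u - b)..u, φ (u - x) * translationOp ρ f x) +
          translationOp ρ (tailOfDensity f) u) := fun u hu =>
    renewalEquation_of_eq_integral hφ hφ01 hφneg hρ hf hf1 hb hu
      (eq_mul_integral_translationOp (C := 1) (s := (lam + δ) / c₂) (by positivity) hρ hf_meas hf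
        hf_neg hφ (fun x => by rw [Real.norm_of_nonneg (hφ01 x).1]; exact (hφ01 x).2) hroot'
        fun v hv => eq_mul_translationOp_of_firstClaim hc₂ hlam hf_meas hf_nonneg
          (hu.trans_le hv) (hfirst v (by linarith)))
  refine ⟨fun u hu => ?_, hrenewal, (integrable_translationOp hρ hf).integrableOn,
    mul_integral_translationOp_lt_one hρ hf_nonneg hf hf_neg hf1 hfx hk.le ?_⟩
  -- Measuring the surplus from b turns the renewal equation on (b, ∞) into one on the positive
  -- half-line, with ψ(y) = φ(y + b) and the integral over [y, y + b] absorbed into the forcing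
  -- term.
  · have hsum := hasSum_of_renewal (G := translationOp ρ f) (h := renewalForcing φ f b ρ)
      (ψ := fun y => φ (y + b)) (k := lam * r / c₂) (measurable_translationOp hf_meas)
      (fun x => ⟨translationOp_nonneg hf_nonneg x, translationOp_le_one hρ hf_nonneg hf hf1 x⟩)
      (hφ.comp (measurable_id.add_const b)) (fun x => hφ01 _) hk
      (fun y _ => renewalForcing_nonneg hφ01 hf_nonneg hρ hf hf1 hb y)
      (fun y hy => by
        have h := hrenewal (y + b) (by linarith)
        rw [add_sub_cancel_right, add_assoc] at h
        rw [h, halfLineConv, renewalForcing]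
        congr 3
        ext x
        rw [sub_add_eq_add_sub, mul_comm]) (sub_pos.2 hu)
    simpa only [sub_add_cancel] using hsum
  · rw [div_mul_eq_mul_div, div_lt_one hc₂]
    exact hnet'
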